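/- All graphs are finite, simple and undirected. A graph is chordal if it has no induced cycle of length at least four. $\alpha(G)$ denotes the maximum size of an independent set of $G$, and $G$ is $1$-extendable if every vertex of $G$ lies in an independent set of size $\alpha(G)$. Theorem. A chordal graph $G$ is $1$-extendable if and only if $V(G)$ can be partitioned into $\alpha(G)$ nonempty parts, each of which is an inclusion-maximal clique of $G$. Moreover, this can be tested in linear time: there is an algorithm (for the unit-cost random access machine with words of $O(\log (n+m+2))$ bits) that, given any chordal graph $G$ with $n$ vertices and $m$ edges by its adjacency lists, decides within $O(n+m+1)$ steps whether $G$ is $1$-extendable. -/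

import Mathlib

/-- A graph is chordal if it has no induced cycle of length at least four. -/
def SimpleGraph.IsChordal {V : Type*} (G : SimpleGraph V) : Prop :=
  ∀ k : ℕ, 4 ≤ k → IsEmpty (SimpleGraph.cycleGraph k ↪g G)

/-- A finite graph is `k`-extendable if every independent set of size exactly `k` is contained in
a maximum independent set. -/
def SimpleGraph.IsExtendable {V : Type*} [Finite V] (k : ℕ) (G : SimpleGraph V) : Prop :=
  ∀ A : Finset V, G.IsNIndepSet k A → ∃ S : Finset V, G.IsMaximumIndepSet S ∧ A ⊆ S

/-! Unit-cost random access machine with words of logarithmic length, programmed in structured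
form. A program mentions finitely many scalar registers and finitely many arrays; the arrays can
be interleaved in a single memory at constant cost per access. -/

namespace RAM

/-- Contents of the scalar registers and of the arrays. -/
structure State where
  /-- content of a scalar register -/
  reg : ℕ → ℕ
  /-- `arr a i` is the content of cell `i` of array `a` -/
  arr : ℕ → ℕ → ℕ

/-- Write `v` into register `x`. -/
def State.setReg (s : State) (x v : ℕ) : State :=
  { s with reg := Function.update s.reg x v }

/-- Write `v` into cell `i` of array `a`. -/
def State.setArr (s : State) (a i v : ℕ) : State :=
  { s with arr := Function.update s.arr a (Function.update (s.arr a) i v) }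

/-- Right-hand sides of elementary assignments; `y` and `z` name registers, `a` names an array. -/
inductive Rhs where
  /-- the constant `k` -/
  | const (k : ℕ)
  /-- the content of register `y` -/
  | copy (y : ℕ)
  /-- the sum of registers `y` and `z` -/
  | add (y z : ℕ)
  /-- the difference of registers `y` and `z`, cut off at zero -/
  | sub (y z : ℕ)
  /-- the cell of array `a` whose index is in register `y` -/
  | load (a y : ℕ)

/-- Value of a right-hand side. -/
def Rhs.eval (s : State) : Rhs → ℕ
  | .const k => k
  | .copy y => s.reg y
  | .add y z => s.reg y + s.reg z
  | .sub y z => s.reg y - s.reg z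
  | .load a y => s.arr a (s.reg y)

/-- Tests comparing two registers. -/
inductive Test where
  /-- register `y` is less than register `z` -/
  | lt (y z : ℕ)
  /-- register `y` equals register `z` -/
  | eq (y z : ℕ)

/-- Truth of a test. -/
def Test.Holds (s : State) : Test → Prop
  | .lt y z => s.reg y < s.reg z
  | .eq y z => s.reg y = s.reg z

/-- Programs. -/
inductive Prog where
  /-- do nothing -/
  | skip
  /-- write the value of `r` into register `x` -/
  | assign (x : ℕ) (r : Rhs)
  /-- write register `y` into the cell of array `a` whose index is in register `x` -/
  | store (a x y : ℕ)
  /-- `p`, then `q` -/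
  | seq (p q : Prog)
  /-- if `b` holds then `p`, else `q` -/
  | cond (b : Test) (p q : Prog)
  /-- while `b` holds do `p` -/
  | loop (b : Test) (p : Prog)

/-- `Exec B p s t s'`: program `p`, started in state `s`, halts in state `s'` after exactly `t`
elementary operations (each assignment, store, `skip` and evaluation of a test counts one), and no
number larger than `B` is ever written into a register or an array cell. -/
inductive Exec (B : ℕ) : Prog → State → ℕ → State → Prop
  | skip (s : State) : Exec B .skip s 1 s
  | assign (s : State) (x : ℕ) (r : Rhs) (h : r.eval s ≤ B) :
      Exec B (.assign x r) s 1 (s.setReg x (r.eval s))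
  | store (s : State) (a x y : ℕ) (h : s.reg y ≤ B) :
      Exec B (.store a x y) s 1 (s.setArr a (s.reg x) (s.reg y))
  | seq {p q : Prog} {s s' s'' : State} {t t' : ℕ}
      (hp : Exec B p s t s') (hq : Exec B q s' t' s'') :
      Exec B (.seq p q) s (t + t') s''
  | cond_true {b : Test} {p q : Prog} {s s' : State} {t : ℕ}
      (hb : b.Holds s) (hp : Exec B p s t s') :
      Exec B (.cond b p q) s (t + 1) s'
  | cond_false {b : Test} {p q : Prog} {s s' : State} {t : ℕ}
      (hb : ¬ b.Holds s) (hq : Exec B q s t s') :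
      Exec B (.cond b p q) s (t + 1) s'
  | loop_true {b : Test} {p : Prog} {s s' s'' : State} {t t' : ℕ}
      (hb : b.Holds s) (hp : Exec B p s t s') (hl : Exec B (.loop b p) s' t' s'') :
      Exec B (.loop b p) s (t + 1 + t') s''
  | loop_false {b : Test} {p : Prog} {s : State} (hb : ¬ b.Holds s) :
      Exec B (.loop b p) s 1 s

/-- The machine is deterministic: running time and final state are determined by the program and
the initial state. -/
theorem Exec.deterministic {B : ℕ} {p : Prog} {s s₁ : State} {t₁ : ℕ} (h₁ : Exec B p s t₁ s₁) :
    ∀ {t₂ : ℕ} {s₂ : State}, Exec B p s t₂ s₂ → t₁ = t₂ ∧ s₁ = s₂ := by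
  induction h₁ with
  | skip s => intro _ _ h; cases h; exact ⟨rfl, rfl⟩
  | assign s x r _ => intro _ _ h; cases h; exact ⟨rfl, rfl⟩
  | store s a x y _ => intro _ _ h; cases h; exact ⟨rfl, rfl⟩
  | seq _ _ ihp ihq =>
    intro _ _ h
    cases h with
    | seq hp hq =>
      obtain ⟨rfl, rfl⟩ := ihp hp
      obtain ⟨rfl, rfl⟩ := ihq hq
      exact ⟨rfl, rfl⟩
  | cond_true hb _ ih =>
    intro _ _ h
    cases h with
    | cond_true _ hp => obtain ⟨rfl, rfl⟩ := ih hp; exact ⟨rfl, rfl⟩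
    | cond_false hn _ => exact absurd hb hn
  | cond_false hb _ ih =>
    intro _ _ h
    cases h with
    | cond_true hn _ => exact absurd hn hb
    | cond_false _ hq => obtain ⟨rfl, rfl⟩ := ih hq; exact ⟨rfl, rfl⟩
  | loop_true hb _ _ ihp ihl =>
    intro _ _ h
    cases h with
    | loop_true _ hp hl =>
      obtain ⟨rfl, rfl⟩ := ihp hp
      obtain ⟨rfl, rfl⟩ := ihl hl
      exact ⟨rfl, rfl⟩
    | loop_false hn => exact absurd hb hn
  | loop_false hb =>
    intro _ _ h
    cases h with
    | loop_true hn _ _ => exact absurd hn hb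
    | loop_false _ => exact ⟨rfl, rfl⟩

/-- `adj` is an adjacency-list representation of `G`: `adj v` lists the neighbours of `v`, each
exactly once, in any order. -/
def IsAdjList {n : ℕ} (G : SimpleGraph (Fin n)) (adj : Fin n → List (Fin n)) : Prop :=
  ∀ v : Fin n, (adj v).Nodup ∧ ∀ u : Fin n, u ∈ adj v ↔ G.Adj v u

/-- The initial state for an adjacency-list representation: register `0` holds the number `n` of
vertices, array `1` holds the concatenation of the lists of the vertices `0, …, n - 1`, and array
`0` holds, for each `v ≤ n`, the total length of the lists of the vertices smaller than `v`, so
that the list of `v` fills the cells of array `1` from the `v`-th entry of array `0` up to (and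
excluding) the entry after it. All other registers and cells are zero. -/
def inputState {n : ℕ} (adj : Fin n → List (Fin n)) : State where
  reg x := if x = 0 then n else 0
  arr a i :=
    if a = 0 then
      if i ≤ n then ((List.ofFn fun v => (adj v).length).take i).sum else 0
    else if a = 1 then
      ((List.ofFn adj).flatten.map Fin.val).getD i 0
    else 0

/-- Membership in `Q` can be decided in linear time for graphs in `D`: one program, given any
adjacency-list representation of any graph in `D` with `n` vertices and `m` edges, halts within
`O(n + m)` steps, uses only words of size `O(n + m)`, and leaves `1` in register `0` if the graph
is in `Q` and `0` otherwise. (The summand `1` only matters for the graph without vertices.) -/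
def DecidableInLinearTime (D Q : ∀ n : ℕ, SimpleGraph (Fin n) → Prop) : Prop :=
  ∃ (p : Prog) (c : ℕ), ∀ (n : ℕ) (G : SimpleGraph (Fin n)) (adj : Fin n → List (Fin n)),
    D n G → IsAdjList G adj →
      ∃ (t : ℕ) (s' : State),
        Exec (c * (n + G.edgeSet.ncard + 1)) p (inputState adj) t s' ∧
        t ≤ c * (n + G.edgeSet.ncard + 1) ∧
        (Q n G → s'.reg 0 = 1) ∧ (¬ Q n G → s'.reg 0 = 0)

end RAM

namespace SimpleGraph

variable {V : Type*} {G : SimpleGraph V}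

/-- The vertices `p 0, …, p k` form an induced path. -/
def InducedPath (G : SimpleGraph V) (p : ℕ → V) (k : ℕ) : Prop :=
  ∀ i j, i < j → j ≤ k → p i ≠ p j ∧ (G.Adj (p i) (p j) ↔ j = i + 1)

theorem InducedPath.reverse {p : ℕ → V} {k : ℕ} (hp : G.InducedPath p k) :
    G.InducedPath (fun i => p (k - i)) k := by
  intro i j hij hj
  have h := hp (k - j) (k - i) (by omega) (by omega)
  refine ⟨h.1.symm, ?_⟩
  rw [G.adj_comm, h.2]
  omega

theorem InducedPath.take {p : ℕ → V} {k l : ℕ} (hp : G.InducedPath p k) (h : l ≤ k) :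
    G.InducedPath p l := fun i j hij hj => hp i j hij (hj.trans h)

theorem InducedPath.adj_iff {p : ℕ → V} {k : ℕ} (hp : G.InducedPath p k) {i j : ℕ} (hi : i ≤ k)
    (hj : j ≤ k) : G.Adj (p i) (p j) ↔ j = i + 1 ∨ i = j + 1 := by
  rcases lt_trichotomy i j with h | rfl | h
  · rw [(hp i j h hj).2]; omega
  · simp
  · rw [G.adj_comm, (hp j i h hi).2]; omega

theorem InducedPath.inj {p : ℕ → V} {k : ℕ} (hp : G.InducedPath p k) {i j : ℕ} (hi : i ≤ k)
    (hj : j ≤ k) (h : p i = p j) : i = j := by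
  rcases lt_trichotomy i j with h' | h' | h'
  · exact absurd h (hp i j h' hj).1
  · exact h'
  · exact absurd h.symm (hp j i h' hi).1

theorem IsChordal.not_closed_inducedPath (hG : G.IsChordal) {p : ℕ → V} {k : ℕ}
    (hp : G.InducedPath p k) (hk : 2 ≤ k) {d : V} (hd : ∀ i ≤ k, d ≠ p i)
    (h : ∀ i ≤ k, G.Adj d (p i) ↔ i = 0 ∨ i = k) : False := by
  refine (hG (k + 2) (by omega)).false ⟨⟨fun i => if i.1 ≤ k then p i.1 else d, ?_⟩, ?_⟩
  · rintro ⟨i, hi⟩ ⟨j, hj⟩ hij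
    simp only at hij
    simp only [Fin.mk.injEq]
    split_ifs at hij with h1 h2 h2
    · exact hp.inj h1 h2 hij
    · exact absurd hij.symm (hd i h1)
    · exact absurd hij (hd j h2)
    · omega
  · rintro ⟨i, hi⟩ ⟨j, hj⟩
    have key : (cycleGraph (k + 2)).Adj ⟨i, hi⟩ ⟨j, hj⟩ ↔
        j = i + 1 ∨ i = j + 1 ∨ (i = 0 ∧ j = k + 1) ∨ (j = 0 ∧ i = k + 1) := by
      rw [cycleGraph_adj', Fin.sub_def, Fin.sub_def]
      simp only
      have e : ∀ a b : ℕ, a < k + 2 → b < k + 2 →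
          ((k + 2 - b + a) % (k + 2) = 1 ↔ a = b + 1 ∨ (a = 0 ∧ b = k + 1)) := by
        intro a b ha hb
        by_cases hab : k + 2 - b + a < k + 2
        · rw [Nat.mod_eq_of_lt hab]; omega
        · rw [Nat.mod_eq_sub_mod (by omega), Nat.mod_eq_of_lt (by omega)]; omega
      rw [e i j hi hj, e j i hj hi]
      omega
    rw [key]
    change G.Adj (if i ≤ k then p i else d) (if j ≤ k then p j else d) ↔ _
    split_ifs with h1 h2 h2
    · rw [hp.adj_iff h1 h2]; omega
    · rw [G.adj_comm, h i h1]; omega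
    · rw [h j h2]; omega
    · simp only [SimpleGraph.irrefl, false_iff]; omega

/-- The ordering of the vertices by `σ` has the property of maximal neighbourhood searches. -/
def IsSearchOrder (G : SimpleGraph V) (σ : V → ℕ) : Prop :=
  ∀ a b c, σ a < σ b → σ b < σ c → G.Adj a c → ¬ G.Adj a b →
    ∃ d, σ d < σ b ∧ G.Adj d b ∧ ¬ G.Adj d c

theorem IsChordal.no_inducedPath_above (hG : G.IsChordal) {σ : V → ℕ}
    (hσ : Function.Injective σ) (hs : G.IsSearchOrder σ) (N : ℕ) :
    ∀ (p : ℕ → V) (k : ℕ), 2 ≤ k → G.InducedPath p k → σ (p 0) < σ (p k) → σ (p k) = N →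
      (∀ i, 0 < i → i < k → σ (p k) < σ (p i)) → False := by
  induction N using Nat.strong_induction_on with
  | _ N ih =>
  intro p k hk hp h0 hN hint
  have h01 : G.Adj (p 0) (p 1) := (hp 0 1 (by omega) (by omega)).2.2 rfl
  have h0k : ¬ G.Adj (p 0) (p k) := by
    rw [(hp 0 k (by omega) le_rfl).2]; omega
  obtain ⟨d, hdσ, hdk, hd1⟩ := hs (p 0) (p k) (p 1) h0 (hint 1 (by omega) (by omega)) h01 h0k
  classical
  have hex : ∃ j, 1 ≤ j ∧ G.Adj d (p j) := ⟨k, by omega, hdk⟩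
  obtain ⟨hj1, hdj⟩ := Nat.find_spec hex
  have hjk : Nat.find hex ≤ k := Nat.find_min' hex ⟨by omega, hdk⟩
  have hmin : ∀ i, 1 ≤ i → i < Nat.find hex → ¬ G.Adj d (p i) :=
    fun i hi hlt hadj => Nat.find_min hex hlt ⟨hi, hadj⟩
  generalize Nat.find hex = j at *
  have hj2 : 2 ≤ j := by
    rcases Nat.lt_or_ge j 2 with h | h
    · obtain rfl : j = 1 := by omega
      exact absurd hdj hd1
    · exact h
  have hge : ∀ i, 1 ≤ i → i ≤ k → σ (p k) ≤ σ (p i) := by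
    intro i hi hik
    rcases hik.lt_or_eq with h | rfl
    · exact (hint i (by omega) h).le
    · exact le_rfl
  have hdne : ∀ i ≤ k, d ≠ p i := by
    rintro i hi rfl
    rcases Nat.eq_zero_or_pos i with rfl | h
    · exact h0k hdk
    · exact absurd hdσ (not_lt.2 (hge i h hi))
  by_cases hd0 : G.Adj d (p 0)
  · refine hG.not_closed_inducedPath (hp.take hjk) hj2 (fun i hi => hdne i (by omega)) ?_
    intro i hi
    constructor
    · intro h
      by_contra hne
      exact hmin i (by omega) (by omega) h
    · rintro (rfl | rfl)
      · exact hd0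
      · exact hdj
  · let q : ℕ → V := fun i => if i ≤ j then p i else d
    have hq : ∀ i ≤ j, q i = p i := fun i hi => if_pos hi
    have hqd : q (j + 1) = d := if_neg (by omega)
    have hqp : G.InducedPath q (j + 1) := by
      intro a b hab hb
      rcases hb.lt_or_eq with h | rfl
      · rw [hq a (by omega), hq b (by omega)]
        exact hp a b hab (by omega)
      · rw [hq a (by omega), hqd]
        refine ⟨(hdne a (by omega)).symm, ?_⟩
        rw [G.adj_comm]
        constructor
        · intro h
          by_contra hne
          rcases Nat.eq_zero_or_pos a with rfl | h'
          · exact hd0 h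
          · exact hmin a h' (by omega) h
        · intro h
          obtain rfl : a = j := by omega
          exact hdj
    have hq0 : q 0 = p 0 := hq 0 (by omega)
    have hqi : ∀ i, 0 < i → i < j + 1 → N ≤ σ (q i) := by
      intro i hi hij
      rw [hq i (by omega), ← hN]
      exact hge i hi (by omega)
    rcases lt_trichotomy (σ (p 0)) (σ d) with h | h | h
    · refine ih (σ d) (by omega) q (j + 1) (by omega) hqp (by rw [hq0, hqd]; exact h)
        (by rw [hqd]) ?_
      intro i hi hij
      have := hqi i hi hij
      rw [hqd]; omega
    · exact hdne 0 (by omega) (hσ h).symm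
    · refine ih (σ (p 0)) (by omega) _ (j + 1) (by omega) hqp.reverse ?_ ?_ ?_
      · simp only [Nat.sub_zero, Nat.sub_self, hq0, hqd]; exact h
      · simp [hq0]
      · intro i hi hij
        have := hqi (j + 1 - i) (by omega) (by omega)
        simp only [Nat.sub_self, hq0]; omega

/-- The neighbours of every vertex that precede it in the ordering by `σ` form a clique. -/
def IsPerfectOrder (G : SimpleGraph V) (σ : V → ℕ) : Prop :=
  ∀ x y z, σ x < σ z → σ y < σ z → G.Adj x z → G.Adj y z → x ≠ y → G.Adj x y

theorem IsChordal.isPerfectOrder (hG : G.IsChordal) {σ : V → ℕ} (hσ : Function.Injective σ)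
    (hs : G.IsSearchOrder σ) : G.IsPerfectOrder σ := by
  have key : ∀ x y z, σ x < σ y → σ y < σ z → G.Adj x z → G.Adj y z → G.Adj x y := by
    intro x y z hxy hyz hxz hyz'
    by_contra hadj
    refine hG.no_inducedPath_above hσ hs (σ y)
      (fun i => if i = 0 then x else if i = 1 then z else y) 2 le_rfl ?_ (by simpa using hxy)
      (by simp) ?_
    · intro i j hij hj
      have : (i = 0 ∧ j = 1) ∨ (i = 0 ∧ j = 2) ∨ (i = 1 ∧ j = 2) := by omega
      rcases this with ⟨rfl, rfl⟩ | ⟨rfl, rfl⟩ | ⟨rfl, rfl⟩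
      · simpa using ⟨hxz.ne, hxz⟩
      · have : x ≠ y := by rintro rfl; exact lt_irrefl _ hxy
        simpa using ⟨this, hadj⟩
      · simpa using ⟨hyz'.ne', hyz'.symm⟩
    · intro i hi hi2
      obtain rfl : i = 1 := by omega
      simpa using hyz
  intro x y z hx hy hxz hyz hne
  rcases lt_trichotomy (σ x) (σ y) with h | h | h
  · exact key x y z h hy hxz hyz
  · exact absurd (hσ h) hne
  · exact (key y x z h hx hyz hxz).symm

section Greedy

open Classical in
/-- The number of entries of the list `l` adjacent to `v`. -/
noncomputable def nbrCount (G : SimpleGraph V) (l : List V) (v : V) : ℕ :=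
  l.countP fun u => G.Adj v u

@[simp] theorem nbrCount_nil (v : V) : G.nbrCount [] v = 0 := by simp [nbrCount]

open Classical in
theorem nbrCount_concat (l : List V) (u v : V) :
    G.nbrCount (l ++ [u]) v = G.nbrCount l v + if G.Adj v u then 1 else 0 := by
  simp [nbrCount, List.countP_append, List.countP_cons]

theorem nbrCount_le_length (l : List V) (v : V) : G.nbrCount l v ≤ l.length :=
  List.countP_le_length

theorem nbrCount_lt {l : List V} {v w u : V} (h : ∀ x ∈ l, G.Adj v x → G.Adj w x) (hu : u ∈ l)
    (hv : ¬ G.Adj v u) (hw : G.Adj w u) : G.nbrCount l v < G.nbrCount l w := by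
  obtain ⟨s, t, rfl⟩ := List.append_of_mem hu
  classical
  have h1 : s.countP (fun x => decide (G.Adj v x)) ≤ s.countP (fun x => decide (G.Adj w x)) :=
    List.countP_mono_left fun x hx => by simpa using h x (by simp [hx])
  have h2 : t.countP (fun x => decide (G.Adj v x)) ≤ t.countP (fun x => decide (G.Adj w x)) :=
    List.countP_mono_left fun x hx => by simpa using h x (by simp [hx])
  simp only [nbrCount, List.countP_append, List.countP_cons, hv, hw, decide_false, decide_true,
    Bool.false_eq_true, if_false, if_true]
  omega

/-- A list without repetitions each of whose entries has the maximum number of neighbours among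
the preceding entries. -/
structure IsMaxCardSearch (G : SimpleGraph V) (o : List V) : Prop where
  nodup : o.Nodup
  le : ∀ pre v post, o = pre ++ v :: post → ∀ w, w ∉ pre → G.nbrCount pre w ≤ G.nbrCount pre v

theorem IsMaxCardSearch.nil : G.IsMaxCardSearch [] :=
  ⟨List.nodup_nil, fun pre v post h => by simp at h⟩

theorem IsMaxCardSearch.concat {o : List V} (ho : G.IsMaxCardSearch o) {v : V} (hv : v ∉ o)
    (h : ∀ w, w ∉ o → G.nbrCount o w ≤ G.nbrCount o v) : G.IsMaxCardSearch (o ++ [v]) := by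
  refine ⟨by simp [List.nodup_append, ho.nodup]; rintro a ha rfl; exact hv ha, ?_⟩
  intro pre x post hx
  rcases List.eq_nil_or_concat post with rfl | ⟨post', y, rfl⟩
  · obtain ⟨rfl, hvx⟩ := List.append_inj' hx rfl
    obtain rfl : v = x := by simpa using hvx
    exact h
  · have : o ++ [v] = (pre ++ x :: post') ++ [y] := by rw [hx]; simp
    exact ho.le pre x post' (List.append_inj' this rfl).1

open Classical in
theorem IsMaxCardSearch.isSearchOrder {o : List V} (ho : G.IsMaxCardSearch o)
    (hall : ∀ v, v ∈ o) : G.IsSearchOrder fun v => o.idxOf v := by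
  intro a b c hab hbc hac hab'
  obtain ⟨pre, post, rfl⟩ := List.append_of_mem (hall b)
  have hnd := ho.nodup
  have hbp : b ∉ pre := by
    intro hb
    simp only [List.nodup_append] at hnd
    exact hnd.2.2 b hb b (by simp) rfl
  have hb : (pre ++ b :: post).idxOf b = pre.length := by
    simp [List.idxOf_append, hbp]
  have hpre : ∀ x, (pre ++ b :: post).idxOf x < pre.length ↔ x ∈ pre := by
    intro x
    rw [List.idxOf_append]
    split_ifs with h
    · simp [h, List.idxOf_lt_length_iff]
    · simp [h]
  simp only [hb] at hab hbc ⊢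
  have ha := (hpre a).1 hab
  have hc : c ∉ pre := fun h => absurd ((hpre c).2 h) (by omega)
  by_contra hcon
  push Not at hcon
  have := ho.le pre b post rfl c hc
  refine absurd (nbrCount_lt (G := G) (l := pre) (v := b) (w := c) (u := a) ?_ ha
    (fun h => hab' h.symm) hac.symm) (by omega)
  intro x hx hbx
  exact (hcon x ((hpre x).2 hx) hbx.symm).symm

theorem exists_isMaxCardSearch [Finite V] (v : V) :
    ∃ o, G.IsMaxCardSearch (v :: o) ∧ ∀ w, w ∈ v :: o := by
  have key : ∀ k, k < Nat.card V → ∃ o, G.IsMaxCardSearch (v :: o) ∧ o.length = k := by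
    intro k
    induction k with
    | zero =>
      intro _
      exact ⟨[], IsMaxCardSearch.nil.concat (v := v) (by simp) (by simp), rfl⟩
    | succ k ih =>
      intro hk
      obtain ⟨o, ho, hlen⟩ := ih (by omega)
      have hne : {w | w ∉ v :: o}.Nonempty := by
        by_contra hcon
        rw [Set.not_nonempty_iff_eq_empty] at hcon
        have hall : ∀ w, w ∈ v :: o := fun w => by
          by_contra h
          have : w ∈ {w | w ∉ v :: o} := h
          rw [hcon] at this
          exact this
        classical
        have := Fintype.ofFinite V
        have h1 : Fintype.card V ≤ (v :: o).length := by
          rw [← List.toFinset_card_of_nodup ho.nodup, ← Finset.card_univ]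
          exact Finset.card_le_card fun w _ => List.mem_toFinset.2 (hall w)
        rw [Nat.card_eq_fintype_card] at hk
        simp only [List.length_cons] at h1
        omega
      obtain ⟨w, hw, hmax⟩ := Set.exists_max_image {w | w ∉ v :: o} (G.nbrCount (v :: o))
        (Set.toFinite _) hne
      exact ⟨o ++ [w], ho.concat hw hmax, by simp [hlen]⟩
  have hpos : 0 < Nat.card V := Nat.card_pos_iff.2 ⟨⟨v⟩, inferInstance⟩
  obtain ⟨o, ho, hlen⟩ := key (Nat.card V - 1) (by omega)
  refine ⟨o, ho, fun w => ?_⟩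
  classical
  have := Fintype.ofFinite V
  have : (v :: o).toFinset = Finset.univ := by
    apply Finset.eq_univ_of_card
    rw [List.toFinset_card_of_nodup ho.nodup, ← Nat.card_eq_fintype_card]
    simp only [List.length_cons]
    omega
  rw [← List.mem_toFinset, this]
  exact Finset.mem_univ w

theorem IsChordal.isPerfectOrder_idxOf [DecidableEq V] (hG : G.IsChordal) {o : List V}
    (ho : G.IsMaxCardSearch o) (hall : ∀ v, v ∈ o) : G.IsPerfectOrder fun v => o.idxOf v := by
  refine hG.isPerfectOrder (fun a b h => (List.idxOf_inj (hall a)).1 h) ?_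
  convert ho.isSearchOrder hall

end Greedy

end SimpleGraph

namespace SimpleGraph

variable {V : Type*} {G : SimpleGraph V}

theorem isExtendable_one_iff [Finite V] :
    G.IsExtendable 1 ↔ ∀ v, ∃ S : Finset V, G.IsMaximumIndepSet S ∧ v ∈ S := by
  constructor
  · intro h v
    obtain ⟨S, hS, hvS⟩ := h {v} ⟨by simp [Set.pairwise_singleton], by simp⟩
    exact ⟨S, hS, by simpa using hvS⟩
  · intro h A hA
    obtain ⟨v, rfl⟩ := Finset.card_eq_one.1 hA.card_eq
    obtain ⟨S, hS, hv⟩ := h v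
    exact ⟨S, hS, by simpa using hv⟩

/-- An independent set meets every fibre of a labelling with clique fibres at most once. -/
theorem IsIndepSet.injOn_of_isClique {ι : Type*} {c : V → ι}
    (hc : ∀ u v, c u = c v → u ≠ v → G.Adj u v) {S : Set V} (hS : G.IsIndepSet S) :
    Set.InjOn c S := by
  intro a ha b hb hab
  by_contra hne
  exact hS ha hb hne (hc a b hab hne)

theorem IsClique.maximal_iff {C : Set V} (hC : G.IsClique C) :
    Maximal G.IsClique C ↔ ∀ x ∉ C, ∃ u ∈ C, ¬ G.Adj x u := by
  constructor
  · intro h x hx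
    by_contra hcon
    push Not at hcon
    exact hx (h.2 (hC.insert fun u hu _ => hcon u hu) (Set.subset_insert x C)
      (Set.mem_insert x C))
  · intro h
    refine ⟨hC, fun D hD hCD x hxD => ?_⟩
    by_contra hx
    obtain ⟨u, hu, hxu⟩ := h x hx
    exact hxu (hD hxD (hCD hu) (by rintro rfl; exact hx hu))

theorem IsChordal.isExtendable_of_maximal [Finite V] (hG : G.IsChordal) {ι : Type*} (c : V → ι)
    (hc : ∀ w, Maximal G.IsClique {u | c u = c w}) : G.IsExtendable 1 := by
  classical
  rw [isExtendable_one_iff]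
  intro v
  have := Fintype.ofFinite V
  obtain ⟨o, ho, hall⟩ := exists_isMaxCardSearch (G := G) v
  have hperf := hG.isPerfectOrder_idxOf ho hall
  have hinj : ∀ a b, (v :: o).idxOf a = (v :: o).idxOf b → a = b :=
    fun a b h => (List.idxOf_inj (hall a)).1 h
  have hv0 : ∀ w, w ≠ v → (v :: o).idxOf v < (v :: o).idxOf w := by
    intro w hw
    rw [List.idxOf_cons_self]
    by_contra h
    exact hw (hinj w v (by rw [List.idxOf_cons_self]; omega))
  obtain ⟨σ, hσ⟩ : ∃ σ : V → ℕ, σ = fun w => (v :: o).idxOf w := ⟨_, rfl⟩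
  replace hinj : ∀ a b, σ a = σ b → a = b := by rw [hσ]; exact hinj
  replace hv0 : ∀ w, w ≠ v → σ v < σ w := by rw [hσ]; exact hv0
  rw [← hσ] at hperf
  have hlast : ∀ w, ∃ l, c l = c w ∧ ∀ u, c u = c w → σ u ≤ σ l := by
    intro w
    obtain ⟨l, hl, hmax⟩ := Set.exists_max_image {u | c u = c w} σ (Set.toFinite _) ⟨w, rfl⟩
    exact ⟨l, hl, hmax⟩
  choose l hl hmax using hlast
  have hlc : ∀ a b, c a = c b → l a = l b := fun a b h => hinj _ _ (le_antisymm
    (hmax b _ ((hl a).trans h)) (hmax a _ ((hl b).trans h.symm)))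
  have hearly : ∀ x w, σ x < σ (l w) → G.Adj x (l w) → c x = c w := by
    intro x w hx hadj
    by_contra hne
    obtain ⟨u, hu, hxu⟩ := (hc w).1.maximal_iff.1 (hc w) x hne
    have hul : u ≠ l w := by rintro rfl; exact hxu hadj
    have hlt : σ u < σ (l w) :=
      lt_of_le_of_ne (hmax w u hu) fun h => hul (hinj _ _ h)
    exact hxu (hperf x u (l w) hx hlt hadj ((hc w).1 hu (hl w) hul)
      (by rintro rfl; exact hne hu))
  let r : V → V := fun w => if c w = c v then v else l w
  have hrc : ∀ w, c (r w) = c w := by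
    intro w
    by_cases h : c w = c v
    · simp only [r, if_pos h, h]
    · simp only [r, if_neg h, hl]
  have hrr : ∀ a b, c a = c b → r a = r b := by
    intro a b h
    simp only [r, h, hlc a b h]
  have hSind : G.IsIndepSet (Finset.univ.image r : Finset V) := by
    have key : ∀ a b, σ (r a) < σ (r b) → ¬ G.Adj (r a) (r b) := by
      intro a b hab hadj
      by_cases hb : c b = c v
      · simp only [r, if_pos hb] at hab hadj
        exact absurd (hv0 _ hadj.ne) (by simpa [r] using hab.not_gt)
      · have hrb : r b = l b := by simp only [r, if_neg hb]
        rw [hrb] at hab hadj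
        have := hearly (r a) b hab hadj
        rw [hrc] at this
        rw [hrr a b this, hrb] at hadj
        exact hadj.ne rfl
    intro x hx y hy hne hadj
    obtain ⟨a, -, rfl⟩ := Finset.mem_image.1 (Finset.mem_coe.1 hx)
    obtain ⟨b, -, rfl⟩ := Finset.mem_image.1 (Finset.mem_coe.1 hy)
    rcases lt_trichotomy (σ (r a)) (σ (r b)) with h | h | h
    · exact key a b h hadj
    · exact hne (hinj _ _ h)
    · exact key b a h hadj.symm
  refine ⟨Finset.univ.image r, ⟨hSind, fun T hT => ?_⟩,
    Finset.mem_image.2 ⟨v, Finset.mem_univ v, by simp [r]⟩⟩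
  have hTi : Set.InjOn c (T : Set V) :=
    IsIndepSet.injOn_of_isClique (fun a b h hne => (hc b).1 h rfl hne) hT
  refine Finset.card_le_card_of_injOn r (fun a _ => Finset.mem_coe.2
    (Finset.mem_image_of_mem r (Finset.mem_univ a))) fun a ha b hb h => hTi ha hb ?_
  rw [← hrc a, h, hrc]

theorem IsExtendable.maximal [Finite V] (h : G.IsExtendable 1) {c : V → V}
    (hc : ∀ u v, c u = c v → u ≠ v → G.Adj u v)
    (hI : G.IsIndepSet (Set.range c)) (w : V) : Maximal G.IsClique {u | c u = c w} := by
  classical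
  have := Fintype.ofFinite V
  have hcl : G.IsClique {u | c u = c w} := fun a ha b hb hne => hc a b (ha.trans hb.symm) hne
  rw [hcl.maximal_iff]
  intro x hx
  by_contra hcon
  push Not at hcon
  obtain ⟨S, hS, hxS⟩ := isExtendable_one_iff.1 h x
  have hinj : Set.InjOn c (S : Set V) := hS.isIndepSet.injOn_of_isClique hc
  have hle : (Finset.univ.image c).card ≤ (S.image c).card := by
    rw [Finset.card_image_of_injOn hinj]
    exact hS.maximum _ (by simpa using hI)
  have heq : S.image c = Finset.univ.image c :=
    Finset.eq_of_subset_of_card_le (Finset.image_subset_image (Finset.subset_univ S)) hle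
  have hw : c w ∈ S.image c := heq ▸ Finset.mem_image_of_mem c (Finset.mem_univ w)
  obtain ⟨u, huS, hu⟩ := Finset.mem_image.1 hw
  exact hS.isIndepSet hxS huS (by rintro rfl; exact hx hu) (hcon u hu)

open Classical in
/-- Greedy cover: the entries of the list are treated from the last to the first, and an entry
that is not yet covered covers itself and all its neighbours not yet covered. The value at `v` is
the vertex that covers `v`. -/
noncomputable def greedyCover (G : SimpleGraph V) : List V → V → Option V
  | [] => fun _ => none
  | w :: l => if G.greedyCover l w = none then
      fun v => if G.greedyCover l v = none ∧ (v = w ∨ G.Adj w v) then some w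
        else G.greedyCover l v
    else G.greedyCover l

/-- What is known of the greedy cover by a suffix of an ordering. -/
structure IsPartialCover (G : SimpleGraph V) (σ : V → ℕ) (l : List V) (g : V → Option V) :
    Prop where
  covered : ∀ v ∈ l, g v ≠ none
  center : ∀ v w, g v = some w → g w = some w ∧ (v = w ∨ (G.Adj w v ∧ σ v < σ w))
  nbr : ∀ w v, g w = some w → G.Adj w v → g v ≠ none
  indep : ∀ v w, g v = some v → g w = some w → ¬ G.Adj v w

theorem isPartialCover_greedyCover {σ : V → ℕ} (l : List V) :
    ∀ pre, (pre ++ l).Pairwise (fun a b => σ a < σ b) → (∀ v, v ∈ pre ++ l) →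
      G.IsPartialCover σ l (G.greedyCover l) := by
  classical
  induction l with
  | nil =>
    intro pre _ _
    exact ⟨by simp, by simp [greedyCover], by simp [greedyCover], by simp [greedyCover]⟩
  | cons w l ih =>
    intro pre hpre hall
    have h := ih (pre ++ [w]) (by simpa using hpre) (by simpa using hall)
    rw [greedyCover]
    split_ifs with hw
    · have hlt : ∀ v, G.greedyCover l v = none → v ≠ w → σ v < σ w := by
        intro v hv hvw
        have hvl : v ∉ l := fun hvl => h.covered v hvl hv
        have hvp : v ∈ pre := by
          have := hall v
          simp only [List.mem_append, List.mem_cons] at this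
          tauto
        exact (List.pairwise_append.1 hpre).2.2 v hvp w (by simp)
      generalize G.greedyCover l = g at *
      refine ⟨?_, ?_, ?_, ?_⟩
      · intro v hv
        split_ifs with hc
        · simp
        · rcases List.mem_cons.1 hv with rfl | hv
          · simp [hw] at hc
          · exact h.covered v hv
      · intro v x
        by_cases hc : g v = none ∧ (v = w ∨ G.Adj w v)
        · rw [if_pos hc]
          rintro ⟨⟩
          refine ⟨by simp [hw], ?_⟩
          by_cases hvw : v = w
          · exact Or.inl hvw
          · exact Or.inr ⟨hc.2.resolve_left hvw, hlt v hc.1 hvw⟩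
        · rw [if_neg hc]
          intro hx
          obtain ⟨h1, h2⟩ := h.center v x hx
          refine ⟨?_, h2⟩
          split_ifs with hc'
          · simp [hc'.1] at h1
          · exact h1
      · intro x v
        split_ifs with hc hc' hc'
        · simp
        · rintro ⟨⟩ hadj
          simp only [hadj, or_true, and_true] at hc'
          exact hc'
        · simp
        · intro hx hadj
          exact h.nbr x v hx hadj
      · intro v x
        split_ifs with hc hc' hc'
        · rintro ⟨⟩ ⟨⟩
          exact G.irrefl
        · rintro ⟨⟩ hx hadj
          exact h.nbr x w hx hadj.symm hw
        · rintro hv ⟨⟩ hadj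
          exact h.nbr v w hv hadj hw
        · exact h.indep v x
    · refine ⟨?_, h.center, h.nbr, h.indep⟩
      intro v hv
      rcases List.mem_cons.1 hv with rfl | hv
      · exact hw
      · exact h.covered v hv

/-- A partition into cliques labelled by the members of an independent set. -/
structure IsCliqueCover (G : SimpleGraph V) (c : V → V) : Prop where
  adj : ∀ u v, c u = c v → u ≠ v → G.Adj u v
  indep : G.IsIndepSet (Set.range c)

theorem IsChordal.exists_isCliqueCover (hG : G.IsChordal) {o : List V}
    (ho : G.IsMaxCardSearch o) (hall : ∀ v, v ∈ o) :
    ∃ c : V → V, G.IsCliqueCover c ∧ ∀ v, G.greedyCover o v = some (c v) := by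
  classical
  have hperf := hG.isPerfectOrder_idxOf ho hall
  have hp : o.Pairwise (fun a b => o.idxOf a < o.idxOf b) := by
    rw [List.pairwise_iff_getElem]
    intro i j hi hj hij
    rwa [ho.nodup.idxOf_getElem, ho.nodup.idxOf_getElem]
  have h := isPartialCover_greedyCover (G := G) (σ := fun v => o.idxOf v) o [] (by simpa using hp)
    (by simpa using hall)
  have hc : ∀ v, ∃ w, G.greedyCover o v = some w := fun v =>
    Option.ne_none_iff_exists'.1 (h.covered v (hall v))
  choose c hc using hc
  refine ⟨c, ⟨?_, ?_⟩, hc⟩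
  · intro u v huv hne
    have h1 := (h.center u _ (hc u)).2
    have h2 := (h.center v _ (hc v)).2
    rw [← huv] at h2
    rcases h1 with h1 | ⟨h1, h1'⟩ <;> rcases h2 with h2 | ⟨h2, h2'⟩
    · exact absurd (h1.trans h2.symm) hne
    · rw [← h1] at h2; exact h2
    · rw [← h2] at h1; exact h1.symm
    · exact hperf u v (c u) h1' h2' h1.symm h2.symm hne
  · rintro _ ⟨a, rfl⟩ _ ⟨b, rfl⟩ _
    exact h.indep _ _ (h.center a _ (hc a)).1 (h.center b _ (hc b)).1

theorem IsCliqueCover.isExtendable_iff [Finite V] {c : V → V} (h : G.IsCliqueCover c)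
    (hG : G.IsChordal) :
    G.IsExtendable 1 ↔ ∀ w, Maximal G.IsClique {u | c u = c w} :=
  ⟨fun he w => he.maximal h.adj h.indep w, fun hm => hG.isExtendable_of_maximal c hm⟩

/-- A chordal graph is 1-extendable if and only if no neighbourhood contains a part of the
greedy cover. -/
theorem IsCliqueCover.isExtendable_iff_forall [Finite V] {c : V → V} (h : G.IsCliqueCover c)
    (hG : G.IsChordal) :
    G.IsExtendable 1 ↔ ∀ x w, ∃ u, c u = c w ∧ ¬ G.Adj x u := by
  rw [h.isExtendable_iff hG]
  have hcl : ∀ w, G.IsClique {u | c u = c w} :=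
    fun w a ha b hb hne => h.adj a b (ha.trans hb.symm) hne
  constructor
  · intro hm x w
    by_cases hx : c x = c w
    · exact ⟨x, hx, G.irrefl⟩
    · exact (hcl w).maximal_iff.1 (hm w) x hx
  · intro hx w
    exact (hcl w).maximal_iff.2 fun x _ => hx x w

open Classical in
/-- The partition into the fibres of a function. -/
noncomputable def fiberPartition {ι : Type*} [Fintype V] (c : V → ι) :
    Finpartition (Set.univ : Set V) where
  parts := Finset.univ.image fun w => {u | c u = c w}
  supIndep := by
    rw [Finset.supIndep_iff_pairwiseDisjoint]
    intro A hA B hB hne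
    obtain ⟨a, -, rfl⟩ := Finset.mem_image.1 (Finset.mem_coe.1 hA)
    obtain ⟨b, -, rfl⟩ := Finset.mem_image.1 (Finset.mem_coe.1 hB)
    refine Set.disjoint_left.2 fun x (hx : c x = c a) (hx' : c x = c b) => hne ?_
    simp only [← hx, ← hx']
  sup_parts := by
    refine Set.eq_univ_of_forall fun v => ?_
    have : (Finset.univ.image fun w => {u | c u = c w}).sup id ≥ {u | c u = c v} :=
      Finset.le_sup (f := id) (Finset.mem_image_of_mem (fun w => {u | c u = c w})
        (Finset.mem_univ v))
    exact this rfl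
  bot_notMem := by
    intro h
    obtain ⟨a, -, ha⟩ := Finset.mem_image.1 h
    have : a ∈ {u | c u = c a} := rfl
    rw [ha] at this
    exact this

theorem IsCliqueCover.card_parts_fiberPartition [Fintype V] {c : V → V} (h : G.IsCliqueCover c) :
    (fiberPartition c).parts.card = G.indepNum := by
  classical
  have hparts : (fiberPartition c).parts.card = (Finset.univ.image c).card := by
    have : (fiberPartition c).parts = (Finset.univ.image c).image fun w => {u | c u = w} := by
      rw [Finset.image_image]
      simp only [fiberPartition]
      congr!
    rw [this]
    refine Finset.card_image_of_injOn ?_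
    intro x hx y hy hxy
    obtain ⟨a, -, rfl⟩ := Finset.mem_image.1 (Finset.mem_coe.1 hx)
    have : a ∈ {u | c u = c a} := rfl
    have h2 : a ∈ {u | c u = y} := by
      have hxy' : {u | c u = c a} = {u | c u = y} := hxy
      rw [← hxy']; exact this
    exact h2
  rw [hparts]
  refine le_antisymm (IsIndepSet.card_le_indepNum (by simpa using h.indep)) ?_
  obtain ⟨S, hS⟩ := G.exists_isNIndepSet_indepNum
  rw [← hS.card_eq, ← Finset.card_image_of_injOn (hS.isIndepSet.injOn_of_isClique h.adj)]
  exact Finset.card_le_card (Finset.image_subset_image (Finset.subset_univ S))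

theorem IsChordal.isExtendable_one_iff_exists_finpartition [Finite V] (hG : G.IsChordal) :
    G.IsExtendable 1 ↔ ∃ P : Finpartition (Set.univ : Set V),
      P.parts.card = G.indepNum ∧ ∀ C ∈ P.parts, Maximal G.IsClique C := by
  classical
  have := Fintype.ofFinite V
  constructor
  · intro he
    have ho : ∃ o, G.IsMaxCardSearch o ∧ ∀ w, w ∈ o := by
      rcases isEmpty_or_nonempty V with hV | ⟨⟨v⟩⟩
      · exact ⟨[], IsMaxCardSearch.nil, fun w => (hV.false w).elim⟩
      · obtain ⟨o, h⟩ := exists_isMaxCardSearch (G := G) v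
        exact ⟨_, h⟩
    obtain ⟨o, ho, hall⟩ := ho
    obtain ⟨c, hc, -⟩ := hG.exists_isCliqueCover ho hall
    refine ⟨fiberPartition c, hc.card_parts_fiberPartition, fun C hC => ?_⟩
    obtain ⟨w, -, rfl⟩ := Finset.mem_image.1 hC
    exact (hc.isExtendable_iff hG).1 he w
  · rintro ⟨P, -, hP⟩
    have hex : ∀ v : V, ∃ C ∈ P.parts, v ∈ C := by
      intro v
      have : v ∈ P.parts.sup id := by rw [P.sup_parts]; trivial
      rw [Finset.sup_id_set_eq_sUnion] at this
      obtain ⟨C, hC, hv⟩ := this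
      exact ⟨C, hC, hv⟩
    choose c hc hvc using hex
    refine hG.isExtendable_of_maximal c fun w => ?_
    have : {u | c u = c w} = c w := by
      ext u
      constructor
      · intro (h : c u = c w)
        rw [← h]
        exact hvc u
      · intro hu
        by_contra hne
        exact Set.disjoint_left.1 (P.disjoint (hc u) (hc w) hne) (hvc u) hu
    rw [this]
    exact hP _ (hc w)

end SimpleGraph

namespace RAM

@[simp] theorem State.setReg_reg (s : State) (x v y : ℕ) :
    (s.setReg x v).reg y = if y = x then v else s.reg y := by
  simp [State.setReg, Function.update_apply]

@[simp] theorem State.setReg_arr (s : State) (x v : ℕ) : (s.setReg x v).arr = s.arr := rfl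

@[simp] theorem State.setArr_reg (s : State) (a i v : ℕ) : (s.setArr a i v).reg = s.reg := rfl

@[simp] theorem State.setArr_arr (s : State) (a i v b : ℕ) :
    (s.setArr a i v).arr b = if b = a then Function.update (s.arr a) i v else s.arr b := by
  simp [State.setArr, Function.update_apply]

/-- The registers that a program may write. -/
def Prog.regs : Prog → List ℕ
  | .skip => []
  | .assign x _ => [x]
  | .store _ _ _ => []
  | .seq p q => p.regs ++ q.regs
  | .cond _ p q => p.regs ++ q.regs
  | .loop _ p => p.regs

/-- The arrays that a program may write. -/
def Prog.arrs : Prog → List ℕ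
  | .skip => []
  | .assign _ _ => []
  | .store a _ _ => [a]
  | .seq p q => p.arrs ++ q.arrs
  | .cond _ p q => p.arrs ++ q.arrs
  | .loop _ p => p.arrs

/-- The states `s` and `s'` agree on everything that `p` does not write. -/
structure Prog.Frame (p : Prog) (s s' : State) : Prop where
  reg : ∀ r, r ∉ p.regs → s'.reg r = s.reg r
  arr : ∀ a, a ∉ p.arrs → s'.arr a = s.arr a

theorem Prog.Frame.refl (p : Prog) (s : State) : p.Frame s s := ⟨fun _ _ => rfl, fun _ _ => rfl⟩

theorem Prog.Frame.trans {p : Prog} {s s' s'' : State} (h : p.Frame s s') (h' : p.Frame s' s'') :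
    p.Frame s s'' :=
  ⟨fun r hr => (h'.reg r hr).trans (h.reg r hr), fun a ha => (h'.arr a ha).trans (h.arr a ha)⟩

theorem Prog.Frame.mono {p q : Prog} {s s' : State} (h : p.Frame s s')
    (hr : p.regs ⊆ q.regs) (ha : p.arrs ⊆ q.arrs) : q.Frame s s' :=
  ⟨fun r h' => h.reg r fun h'' => h' (hr h''), fun a h' => h.arr a fun h'' => h' (ha h'')⟩

theorem Exec.frame {B : ℕ} {p : Prog} {s s' : State} {t : ℕ} (h : Exec B p s t s') :
    p.Frame s s' := by
  induction h with
  | skip s => exact .refl _ _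
  | assign s x r _ =>
    refine ⟨fun y hy => ?_, fun _ _ => rfl⟩
    simp only [Prog.regs, List.mem_singleton] at hy
    simp [hy]
  | store s a x y _ =>
    refine ⟨fun _ _ => rfl, fun b hb => ?_⟩
    simp only [Prog.arrs, List.mem_singleton] at hb
    simp [hb]
  | seq _ _ ihp ihq =>
    exact (ihp.mono (by simp [Prog.regs]) (by simp [Prog.arrs])).trans
      (ihq.mono (by simp [Prog.regs]) (by simp [Prog.arrs]))
  | cond_true _ _ ih => exact ih.mono (by simp [Prog.regs]) (by simp [Prog.arrs])
  | cond_false _ _ ih => exact ih.mono (by simp [Prog.regs]) (by simp [Prog.arrs])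
  | loop_true _ _ _ ihp ihl =>
    exact (ihp.mono (by simp [Prog.regs]) (by simp [Prog.arrs])).trans ihl
  | loop_false _ => exact .refl _ _

/-- Started in state `s` with `T` credits, the program `p` halts after spending at most `T`
credits, and the remaining credits and the final state satisfy `Q`. -/
def Runs (B : ℕ) (p : Prog) (s : State) (T : ℕ) (Q : ℕ → State → Prop) : Prop :=
  ∃ t s', Exec B p s t s' ∧ t ≤ T ∧ Q (T - t) s'

variable {B : ℕ} {p q : Prog} {s : State} {T : ℕ} {Q Q' : ℕ → State → Prop}

theorem Runs.mono (h : Runs B p s T Q) (hQ : ∀ T' s', p.Frame s s' → Q T' s' → Q' T' s') :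
    Runs B p s T Q' := by
  obtain ⟨t, s', he, ht, hq⟩ := h
  exact ⟨t, s', he, ht, hQ _ _ he.frame hq⟩

theorem Runs.add (h : Runs B p s T Q) (k : ℕ) :
    Runs B p s (T + k) fun T' s' => k ≤ T' ∧ Q (T' - k) s' := by
  obtain ⟨t, s', he, ht, hq⟩ := h
  refine ⟨t, s', he, by omega, by omega, ?_⟩
  rwa [show T + k - t - k = T - t by omega]

theorem runs_skip : Runs B .skip s T Q ↔ 1 ≤ T ∧ Q (T - 1) s := by
  constructor
  · rintro ⟨t, s', he, ht, hq⟩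
    cases he
    exact ⟨ht, hq⟩
  · rintro ⟨ht, hq⟩
    exact ⟨1, s, .skip s, ht, hq⟩

theorem runs_assign {x : ℕ} {r : Rhs} : Runs B (.assign x r) s T Q ↔
    1 ≤ T ∧ r.eval s ≤ B ∧ Q (T - 1) (s.setReg x (r.eval s)) := by
  constructor
  · rintro ⟨t, s', he, ht, hq⟩
    cases he with
    | assign _ _ _ h => exact ⟨ht, h, hq⟩
  · rintro ⟨ht, h, hq⟩
    exact ⟨1, _, .assign s x r h, ht, hq⟩

theorem runs_store {a x y : ℕ} : Runs B (.store a x y) s T Q ↔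
    1 ≤ T ∧ s.reg y ≤ B ∧ Q (T - 1) (s.setArr a (s.reg x) (s.reg y)) := by
  constructor
  · rintro ⟨t, s', he, ht, hq⟩
    cases he with
    | store _ _ _ _ h => exact ⟨ht, h, hq⟩
  · rintro ⟨ht, h, hq⟩
    exact ⟨1, _, .store s a x y h, ht, hq⟩

theorem runs_seq : Runs B (.seq p q) s T Q ↔ Runs B p s T fun T' s' => Runs B q s' T' Q := by
  constructor
  · rintro ⟨t, s', he, ht, hq⟩
    cases he with
    | seq hp hq' =>
      refine ⟨_, _, hp, by omega, _, _, hq', by omega, ?_⟩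
      rwa [Nat.sub_sub]
  · rintro ⟨t, s', hp, ht, t', s'', hq', ht', h⟩
    refine ⟨_, _, .seq hp hq', by omega, ?_⟩
    rwa [← Nat.sub_sub]

theorem runs_cond {b : Test} : Runs B (.cond b p q) s T Q ↔
    1 ≤ T ∧ (b.Holds s → Runs B p s (T - 1) Q) ∧ (¬ b.Holds s → Runs B q s (T - 1) Q) := by
  constructor
  · rintro ⟨t, s', he, ht, hq⟩
    cases he with
    | cond_true hb hp =>
      refine ⟨by omega, fun _ => ⟨_, _, hp, by omega, ?_⟩, fun h => absurd hb h⟩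
      convert hq using 1; omega
    | cond_false hb hp =>
      refine ⟨by omega, fun h => absurd h hb, fun _ => ⟨_, _, hp, by omega, ?_⟩⟩
      convert hq using 1; omega
  · rintro ⟨hT, h1, h2⟩
    by_cases hb : b.Holds s
    · obtain ⟨t, s', he, ht, hq⟩ := h1 hb
      refine ⟨_, _, .cond_true hb he, by omega, ?_⟩
      convert hq using 1; omega
    · obtain ⟨t, s', he, ht, hq⟩ := h2 hb
      refine ⟨_, _, .cond_false hb he, by omega, ?_⟩
      convert hq using 1; omega

/-- The rule for loops: the invariant speaks of the remaining credits, which bound the number of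
rounds. -/
theorem Runs.loop {b : Test} (Inv : ℕ → State → Prop) (h0 : Inv T s)
    (step : ∀ T' s', p.Frame s s' → Inv T' s' → b.Holds s' → 1 ≤ T' ∧ Runs B p s' (T' - 1) Inv)
    (exit : ∀ T' s', p.Frame s s' → Inv T' s' → ¬ b.Holds s' → 1 ≤ T' ∧ Q (T' - 1) s') :
    Runs B (.loop b p) s T Q := by
  have key : ∀ N T' s', T' ≤ N → p.Frame s s' → Inv T' s' → Runs B (.loop b p) s' T' Q := by
    intro N
    induction N with
    | zero =>
      intro T' s' hN hf hI
      by_cases hb : b.Holds s'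
      · exact absurd (step T' s' hf hI hb).1 (by omega)
      · exact absurd (exit T' s' hf hI hb).1 (by omega)
    | succ N ih =>
      intro T' s' hN hf hI
      by_cases hb : b.Holds s'
      · obtain ⟨h1, t, s'', he, ht, hI'⟩ := step T' s' hf hI hb
        obtain ⟨t', s₃, he', ht', hq⟩ := ih _ s'' (by omega) (hf.trans he.frame) hI'
        refine ⟨_, _, .loop_true hb he he', by omega, ?_⟩
        convert hq using 1; omega
      · obtain ⟨h1, hq⟩ := exit T' s' hf hI hb
        exact ⟨_, _, .loop_false hb, h1, hq⟩
  exact key T T s le_rfl (.refl _ _) h0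

section Adj

variable {n : ℕ} {adj : Fin n → List (Fin n)}

/-- The total length of adjacency lists. -/
def totalLength (adj : Fin n → List (Fin n)) : ℕ := ∑ v, (adj v).length

/-- The state contains the adjacency lists in the format of the initial state. -/
structure HasInput (adj : Fin n → List (Fin n)) (s : State) : Prop where
  offset : s.arr 0 = (inputState adj).arr 0
  nbr : s.arr 1 = (inputState adj).arr 1

theorem HasInput.congr {s s' : State} (h : HasInput adj s) (h0 : s'.arr 0 = s.arr 0)
    (h1 : s'.arr 1 = s.arr 1) : HasInput adj s' :=
  ⟨h0.trans h.offset, h1.trans h.nbr⟩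

theorem inputState_offset_succ (v : Fin n) :
    (inputState adj).arr 0 (v + 1) = (inputState adj).arr 0 v + (adj v).length := by
  have h1 : (v : ℕ) + 1 ≤ n := v.2
  have h2 : (v : ℕ) ≤ n := v.2.le
  simp only [inputState, if_true, h1, h2]
  rw [List.take_add_one, List.sum_append]
  simp

theorem inputState_offset_le (i : ℕ) : (inputState adj).arr 0 i ≤ totalLength adj := by
  simp only [inputState, if_true]
  split_ifs with h
  · rw [totalLength, ← List.sum_ofFn]
    conv_rhs => rw [← List.take_append_drop i (List.ofFn _), List.sum_append]
    omega
  · omega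

theorem inputState_nbr (v : Fin n) (i : ℕ) (h : i < (adj v).length) :
    (inputState adj).arr 1 ((inputState adj).arr 0 v + i) = (adj v)[i] := by
  have h2 : (v : ℕ) ≤ n := v.2.le
  simp only [inputState, if_true, h2, one_ne_zero, if_false]
  have e1 : List.ofFn adj = (List.ofFn adj).take v ++ adj v :: (List.ofFn adj).drop (v + 1) := by
    conv_lhs => rw [← List.take_append_drop v (List.ofFn adj)]
    rw [List.drop_eq_getElem_cons (by simp)]
    simp
  have e2 : ((List.ofFn fun v => (adj v).length).take v).sum
      = ((List.ofFn adj).take v).flatten.length := by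
    rw [List.length_flatten, List.map_take, List.map_ofFn]
    rfl
  rw [e1, e2, List.flatten_append, List.flatten_cons, List.map_append, List.map_append]
  rw [List.getD_append_right _ _ _ _ (by rw [List.length_map]; omega)]
  simp only [List.length_map, Nat.add_sub_cancel_left]
  rw [List.getD_append _ _ _ _ (by simpa using h)]
  simp [List.getD_eq_getElem?_getD, h]

/-- The loop over the adjacency list of the vertex in register `x`: the current neighbour is in
register `6`, and registers `3`, `4`, `5` are used for the traversal. -/
def adjLoop (x : ℕ) (body : Prog) : Prog :=
  .seq (.assign 3 (.load 0 x)) <|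
  .seq (.assign 5 (.add x 1)) <|
  .seq (.assign 4 (.load 0 5)) <|
  .loop (.lt 3 4) <|
  .seq (.assign 6 (.load 1 3)) <|
  .seq body <|
  .assign 3 (.add 3 1)

theorem Runs.adjLoop {x : ℕ} {body : Prog} {v : Fin n} (hin : HasInput adj s)
    (hB : n + totalLength adj + 2 ≤ B) (hx : s.reg x = v) (h1 : s.reg 1 = 1)
    (hx3 : x ≠ 3) (hbr : ∀ r ∈ [1, 3, 4], r ∉ body.regs) (hba : ∀ a ∈ [0, 1], a ∉ body.arrs)
    (Inv : List (Fin n) → ℕ → State → Prop)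
    (h0 : 3 ≤ T ∧ ∀ i e j, Inv [] (T - 3) (((s.setReg 3 i).setReg 5 e).setReg 4 j))
    (step : ∀ (pre : List (Fin n)) (u : Fin n) (post : List (Fin n)) (T' : ℕ) (s' : State),
      adj v = pre ++ u :: post → (adjLoop x body).Frame s s' → Inv pre T' s' →
      3 ≤ T' ∧ Runs B body (s'.setReg 6 u) (T' - 3)
        fun T'' s'' => ∀ i, Inv (pre ++ [u]) T'' (s''.setReg 3 i))
    (exit : ∀ T' s', (adjLoop x body).Frame s s' → Inv (adj v) T' s' → 1 ≤ T' ∧ Q (T' - 1) s') :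
    Runs B (RAM.adjLoop x body) s T Q := by
  have hv := v.2
  have hoff := fun i => inputState_offset_le (adj := adj) i
  simp only [RAM.adjLoop, runs_seq, runs_assign, Rhs.eval]
  simp only [State.setReg_reg, State.setReg_arr, hin.offset, hx, hx3, h1, if_true, if_false,
    inputState_offset_succ, OfNat.one_ne_ofNat]
  refine ⟨by omega, (hoff _).trans (by omega), by omega, by omega, by omega, ?_, ?_⟩
  · rw [← inputState_offset_succ]
    exact (hoff _).trans (by omega)
  set s₀ : State := ((s.setReg 3 ((inputState adj).arr 0 v)).setReg 5 (v + 1)).setReg 4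
    ((inputState adj).arr 0 v + (adj v).length) with hs₀
  have hframe₀ : (RAM.adjLoop x body).Frame s s₀ := by
    refine ⟨fun r hr => ?_, fun a _ => rfl⟩
    simp only [RAM.adjLoop, Prog.regs, List.cons_append, List.nil_append, List.mem_cons,
      not_or] at hr
    simp [hs₀, hr.1, hr.2.1, hr.2.2.1]
  have hframe : ∀ s', (Prog.seq (.assign 6 (.load 1 3)) (.seq body (.assign 3 (.add 3 1)))).Frame
      s₀ s' → (RAM.adjLoop x body).Frame s s' := by
    intro s' h
    refine hframe₀.trans (h.mono ?_ ?_)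
    · intro r hr
      simp only [RAM.adjLoop, Prog.regs, List.mem_append] at hr ⊢
      tauto
    · intro r hr
      simp only [RAM.adjLoop, Prog.arrs, List.mem_append] at hr ⊢
      tauto
  refine Runs.loop (fun T' s' => ∃ pre post, adj v = pre ++ post ∧
    s'.reg 3 = (inputState adj).arr 0 v + pre.length ∧ Inv pre T' s') ?_ ?_ ?_
  · refine ⟨[], adj v, rfl, by simp [hs₀], ?_⟩
    exact h0.2 _ _ _
  · rintro T' s' hf ⟨pre, post, hadj, h3, hI⟩ hb
    have h4 : s'.reg 4 = (inputState adj).arr 0 v + (adj v).length := by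
      rw [hf.reg 4 (by have := hbr 4 (by simp); simp [Prog.regs, this])]
      simp [hs₀]
    have h1' : s'.reg 1 = 1 := by
      rw [hf.reg 1 (by have := hbr 1 (by simp); simp [Prog.regs, this])]
      simp [hs₀, h1]
    have ha1 : s'.arr 1 = (inputState adj).arr 1 := by
      rw [hf.arr 1 (by have := hba 1 (by simp); simp [Prog.arrs, this])]
      exact hin.nbr
    simp only [Test.Holds, h3, h4] at hb
    rcases post with _ | ⟨u, post⟩
    · rw [hadj] at hb; simp at hb
    have hu : s'.arr 1 (s'.reg 3) = u := by
      rw [ha1, h3, inputState_nbr v _ (by omega)]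
      simp [hadj]
    obtain ⟨hT, hrun⟩ := step pre u post T' s' hadj (hframe s' hf) hI
    refine ⟨by omega, ?_⟩
    simp only [runs_seq, runs_assign, Rhs.eval, hu]
    refine ⟨by omega, by have := u.2; omega, ?_⟩
    have hrun' := hrun.add 1
    rw [show T' - 3 + 1 = T' - 1 - 1 by omega] at hrun'
    refine hrun'.mono fun T'' s'' hf' h => ?_
    have e3 : s''.reg 3 = (inputState adj).arr 0 v + pre.length := by
      rw [hf'.reg 3 (hbr 3 (by simp))]
      simpa using h3
    have e1 : s''.reg 1 = 1 := by
      rw [hf'.reg 1 (hbr 1 (by simp))]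
      simpa using h1'
    rw [e1, e3]
    refine ⟨h.1, ?_, pre ++ [u], post, by simp [hadj], by simp [add_assoc], h.2 _⟩
    have := hoff (v + 1)
    rw [inputState_offset_succ] at this
    omega
  · rintro T' s' hf ⟨pre, post, hadj, h3, hI⟩ hb
    have h4 : s'.reg 4 = (inputState adj).arr 0 v + (adj v).length := by
      rw [hf.reg 4 (by have := hbr 4 (by simp); simp [Prog.regs, this])]
      simp [hs₀]
    simp only [Test.Holds, h3, h4] at hb
    have : post = [] := by
      rw [← List.length_eq_zero_iff]
      rw [hadj, List.length_append] at hb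
      omega
    subst this
    rw [List.append_nil] at hadj
    exact exit T' s' (hframe s' hf) (hadj ▸ hI)

theorem sum_length_le_totalLength {l : List (Fin n)} (hl : l.Nodup) :
    (l.map fun v => (adj v).length).sum ≤ totalLength adj := by
  rw [← List.sum_toFinset _ hl]
  exact Finset.sum_le_sum_of_subset (Finset.subset_univ _)

end Adj

end RAM

namespace RAM

variable {B : ℕ} {s : State} {T : ℕ} {Q : ℕ → State → Prop}
variable {n : ℕ} {adj : Fin n → List (Fin n)} {G : SimpleGraph (Fin n)}

/-- The machine number of an optional vertex. -/
def code : Option (Fin n) → ℕ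
  | none => 0
  | some w => w + 1

@[simp] theorem code_none : code (none : Option (Fin n)) = 0 := rfl

@[simp] theorem code_some (w : Fin n) : code (some w) = w + 1 := rfl

@[simp] theorem code_eq_zero {o : Option (Fin n)} : code o = 0 ↔ o = none := by
  cases o <;> simp

theorem code_le (o : Option (Fin n)) : code o ≤ n := by
  cases o with
  | none => simp
  | some w => have := w.2; simp

/-- Cover the vertex in register `6` unless it is covered. -/
def coverNbr : Prog :=
  .seq (.assign 13 (.load 8 6)) <|
  .cond (.eq 13 2) (.store 8 6 14) .skip

/-- Treat the vertices of the ordering in array `7` from the last to the first, and write the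
greedy cover into array `8`. -/
def coverLoop : Prog :=
  .loop (.lt 2 7) <|
  .seq (.assign 7 (.sub 7 1)) <|
  .seq (.assign 12 (.load 7 7)) <|
  .seq (.assign 13 (.load 8 12)) <|
  .cond (.eq 13 2)
    (.seq (.assign 14 (.add 12 1)) <|
     .seq (.store 8 12 14) <|
     adjLoop 12 coverNbr)
    .skip

open Classical in
theorem runs_coverNbrs {w : Fin n} {g : Fin n → Option (Fin n)} (hin : HasInput adj s)
    (hB : n + totalLength adj + 2 ≤ B) (h12 : s.reg 12 = w) (h1 : s.reg 1 = 1) (h2 : s.reg 2 = 0)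
    (h14 : s.reg 14 = w + 1) (hg : ∀ v : Fin n, s.arr 8 v = code (g v)) {R : ℕ}
    (hT : R + 6 * (adj w).length + 4 ≤ T) :
    Runs B (adjLoop 12 coverNbr) s T fun T' s' => R ≤ T' ∧
      ∀ v : Fin n, s'.arr 8 v = code (if g v = none ∧ v ∈ adj w then some w else g v) := by
  refine Runs.adjLoop hin hB h12 h1 (by decide) (by decide) (by decide)
    (fun pre T' s' => R + 6 * ((adj w).length - pre.length) + 1 ≤ T' ∧
      ∀ v : Fin n, s'.arr 8 v = code (if g v = none ∧ v ∈ pre then some w else g v)) ?_ ?_ ?_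
  · refine ⟨by omega, fun i e j => ⟨by simp only [List.length_nil]; omega, ?_⟩⟩
    simpa using hg
  · rintro pre u post T' s' hadj hf ⟨hT', hcov⟩
    have hlen : (adj w).length = pre.length + (post.length + 1) := by rw [hadj]; simp
    have e2 : s'.reg 2 = 0 := by rw [hf.reg 2 (by decide), h2]
    have e14 : s'.reg 14 = w + 1 := by rw [hf.reg 14 (by decide), h14]
    have hw := w.2
    have hle : s'.arr 8 u ≤ n := by rw [hcov]; exact code_le _
    refine ⟨by omega, ?_⟩
    simp only [coverNbr, runs_seq, runs_assign, runs_cond, runs_store, runs_skip, Rhs.eval,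
      Test.Holds, State.setReg_reg, State.setReg_arr, State.setArr_arr, e2, e14]
    simp only [reduceIte, Nat.reduceEqDiff]
    refine ⟨by omega, by omega, by omega, fun hb => ⟨by omega, by omega, fun i => ⟨?_, ?_⟩⟩,
      fun hb => ⟨by omega, fun i => ⟨?_, ?_⟩⟩⟩
    · simp only [List.length_append, List.length_singleton]; omega
    · intro v
      rw [hcov, code_eq_zero] at hb
      by_cases hv : v = u
      · subst hv
        have : g v = none := by
          split_ifs at hb with h
          exact hb
        simp [this]
      · have hv' : (v : ℕ) ≠ u := fun h => hv (Fin.ext h)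
        simp [hv', hcov, hv]
    · simp only [List.length_append, List.length_singleton]; omega
    · intro v
      rw [hcov, code_eq_zero] at hb
      simp only [hcov]
      by_cases hv : v = u
      · subst hv
        by_cases hgv : g v = none
        · by_cases hvp : v ∈ pre
          · simp [hvp]
          · simp [hvp, hgv] at hb
        · simp [hgv]
      · simp [hv]
  · rintro T' s' hf ⟨hT', hcov⟩
    exact ⟨by omega, by omega, hcov⟩

theorem runs_coverLoop {o : List (Fin n)} (hin : HasInput adj s) (hG : IsAdjList G adj)
    (hB : n + totalLength adj + 2 ≤ B) (h0 : s.reg 7 = o.length) (h1 : s.reg 1 = 1)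
    (h2 : s.reg 2 = 0) (hn : o.length ≤ n) (ho : ∀ i (h : i < o.length), s.arr 7 i = o[i])
    (h8 : ∀ v, s.arr 8 v = 0) {R : ℕ}
    (hT : R + (12 * o.length + 6 * (o.map fun v => (adj v).length).sum) + 1 ≤ T) :
    Runs B coverLoop s T fun T' s' => R ≤ T' ∧ s'.reg 7 = 0 ∧
      ∀ v : Fin n, s'.arr 8 v = code (G.greedyCover o v) := by
  classical
  refine Runs.loop (fun T' s' => ∃ pre post, o = pre ++ post ∧ s'.reg 7 = pre.length ∧
    (∀ v : Fin n, s'.arr 8 v = code (G.greedyCover post v)) ∧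
    R + (12 * pre.length + 6 * (pre.map fun v => (adj v).length).sum) + 1 ≤ T') ?_ ?_ ?_
  · exact ⟨o, [], by simp, h0, by simp [SimpleGraph.greedyCover, h8], hT⟩
  · rintro T' s' hf ⟨pre, post, rfl, h7, hcov, hT'⟩ hb
    have e1 : s'.reg 1 = 1 := by rw [hf.reg 1 (by decide), h1]
    have e2 : s'.reg 2 = 0 := by rw [hf.reg 2 (by decide), h2]
    simp only [Test.Holds, e2, h7] at hb
    rcases List.eq_nil_or_concat' pre with rfl | ⟨pre, w, rfl⟩
    · simp at hb
    have e7 : s'.arr 7 pre.length = w := by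
      rw [hf.arr 7 (by decide), ho _ (by simp)]
      simp
    have hw := w.2
    have hle : s'.arr 8 w ≤ n := by rw [hcov]; exact code_le _
    simp only [List.length_append, List.length_singleton, List.map_append, List.sum_append,
      List.map_cons, List.map_nil, List.sum_singleton] at h7 hT' hn
    refine ⟨by omega, ?_⟩
    simp only [runs_seq, runs_assign, runs_cond, runs_store, runs_skip, Rhs.eval,
      Test.Holds, State.setReg_reg, State.setReg_arr, e2, e1]
    simp only [reduceIte, Nat.reduceEqDiff, h7, Nat.add_sub_cancel, e7]
    refine ⟨by omega, by omega, by omega, by omega, by omega, by omega, by omega,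
      fun hb => ⟨by omega, by omega, by omega, by omega, ?_⟩,
      fun hb => ⟨by omega, pre, w :: post, by simp, by simp, ?_, by omega⟩⟩
    · rw [hcov, code_eq_zero] at hb
      refine (runs_coverNbrs (w := w)
        (g := fun v => if v = w then some w else G.greedyCover post v)
        (R := R + (12 * pre.length + 6 * (pre.map fun v => (adj v).length).sum) + 1)
        ?_ hB ?_ ?_ ?_ ?_ ?_ ?_).mono ?_
      · refine hin.congr ?_ ?_
        · simpa using hf.arr 0 (by decide)
        · simpa using hf.arr 1 (by decide)
      · simp
      · simp [e1]
      · simp [e2]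
      · simp
      · intro v
        by_cases hv : v = w
        · simp [hv]
        · have hv' : (v : ℕ) ≠ w := fun h => hv (Fin.ext h)
          simp [hv', hcov, hv]
      · omega
      · rintro T'' s'' hf' ⟨hT'', h⟩
        refine ⟨pre, w :: post, by simp, ?_, ?_, hT''⟩
        · rw [hf'.reg 7 (by decide)]
          simp
        · intro v
          rw [h, SimpleGraph.greedyCover, if_pos hb]
          congr 1
          by_cases hv : v = w
          · simp [hv, hb]
          · simp [hv, (hG w).2]
    · rw [hcov, code_eq_zero] at hb
      intro v
      rw [SimpleGraph.greedyCover, if_neg hb]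
      simpa using hcov v
  · rintro T' s' hf ⟨pre, post, rfl, h7, hcov, hT'⟩ hb
    have e2 : s'.reg 2 = 0 := by rw [hf.reg 2 (by decide), h2]
    simp only [Test.Holds, e2, h7] at hb
    obtain rfl : pre = [] := List.length_eq_zero_iff.1 (by omega)
    exact ⟨by omega, by omega, by simpa using h7, hcov⟩

/-- Write the sizes of the parts into array `9`. -/
def sizeLoop : Prog :=
  .loop (.lt 7 0) <|
  .seq (.assign 13 (.load 8 7)) <|
  .seq (.assign 14 (.load 9 13)) <|
  .seq (.assign 14 (.add 14 1)) <|
  .seq (.store 9 13 14) <|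
  .assign 7 (.add 7 1)

theorem runs_sizeLoop {f : Fin n → ℕ} (hB : n + 2 ≤ B) (h0 : s.reg 0 = n) (h1 : s.reg 1 = 1)
    (h7 : s.reg 7 = 0) (h8 : ∀ v : Fin n, s.arr 8 v = f v) (hf : ∀ v, f v ≤ n)
    (h9 : ∀ c, s.arr 9 c = 0) {R : ℕ} (hT : R + 6 * n + 1 ≤ T) :
    Runs B sizeLoop s T fun T' s' => R ≤ T' ∧
      ∀ c, s'.arr 9 c = (List.finRange n).countP (fun v => f v = c) := by
  refine Runs.loop (fun T' s' => s'.reg 7 ≤ n ∧ R + 6 * (n - s'.reg 7) + 1 ≤ T' ∧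
    ∀ c, s'.arr 9 c = ((List.finRange n).take (s'.reg 7)).countP (fun v => f v = c)) ?_ ?_ ?_
  · simp [h7, h9]; omega
  · rintro T' s' hfr ⟨hle, hT', hcount⟩ hb
    have e0 : s'.reg 0 = n := by rw [hfr.reg 0 (by decide), h0]
    have e1 : s'.reg 1 = 1 := by rw [hfr.reg 1 (by decide), h1]
    simp only [Test.Holds, e0] at hb
    have e8 : s'.arr 8 (s'.reg 7) = f ⟨s'.reg 7, hb⟩ := by
      rw [hfr.arr 8 (by decide), ← h8]
    have hfv := hf ⟨s'.reg 7, hb⟩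
    have hc : ∀ c, s'.arr 9 c ≤ n := by
      intro c
      rw [hcount]
      refine List.countP_le_length.trans ?_
      simp
    have hcv := hc (f ⟨s'.reg 7, hb⟩)
    refine ⟨by omega, ?_⟩
    simp only [runs_seq, runs_assign, runs_store, Rhs.eval,
      State.setReg_reg, State.setReg_arr, State.setArr_reg, State.setArr_arr, e1]
    simp only [reduceIte, Nat.reduceEqDiff, e8]
    refine ⟨by omega, by omega, by omega, by omega, by omega, by omega, by omega, by omega,
      by omega, by omega, by omega, by omega, fun c => ?_⟩
    rw [List.take_add_one, List.countP_append, ← hcount]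
    have : (List.finRange n)[s'.reg 7]? = some ⟨s'.reg 7, hb⟩ := by simp [hb]
    rw [this]
    by_cases hcf : c = f ⟨s'.reg 7, hb⟩
    · simp [hcf]
    · simp [hcf, Ne.symm hcf]
  · rintro T' s' hfr ⟨hle, hT', hcount⟩ hb
    have e0 : s'.reg 0 = n := by rw [hfr.reg 0 (by decide), h0]
    simp only [Test.Holds, e0] at hb
    refine ⟨by omega, by omega, fun c => ?_⟩
    rw [hcount, List.take_of_length_le (by simpa using hb)]

/-- Count the vertex in register `6` for its part, and lower the flag in register `16` if the
count reaches the size of the part. -/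
def countNbr : Prog :=
  .seq (.assign 13 (.load 8 6)) <|
  .seq (.assign 14 (.load 10 13)) <|
  .seq (.assign 14 (.add 14 1)) <|
  .seq (.store 10 13 14) <|
  .seq (.assign 15 (.load 9 13)) <|
  .cond (.lt 14 15) .skip (.assign 16 (.const 0))

/-- Reset the count of the part of the vertex in register `6`. -/
def resetNbr : Prog :=
  .seq (.assign 13 (.load 8 6)) <|
  .store 10 13 2

/-- Test whether some neighbourhood contains a part. -/
def testLoop : Prog :=
  .loop (.lt 17 0) <|
  .seq (adjLoop 17 countNbr) <|
  .seq (adjLoop 17 resetNbr) <|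
  .assign 17 (.add 17 1)

/-- The list `l` contains at least `z c` vertices of some part `c` that it meets. -/
def ReachesSize (f : Fin n → ℕ) (z : ℕ → ℕ) (l : List (Fin n)) : Prop :=
  ∃ u ∈ l, z (f u) ≤ l.countP fun v => f v = f u

/-- The adjacency list of a vertex smaller than `i` contains all of some part. -/
def ReachesSizeBelow (adj : Fin n → List (Fin n)) (f : Fin n → ℕ) (z : ℕ → ℕ) (i : ℕ) : Prop :=
  ∃ x : Fin n, x < i ∧ ReachesSize f z (adj x)

theorem runs_countNbrs {x : Fin n} {f : Fin n → ℕ} {z : ℕ → ℕ} (hin : HasInput adj s)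
    (hB : n + totalLength adj + 2 ≤ B) (h17 : s.reg 17 = x) (h1 : s.reg 1 = 1)
    (h8 : ∀ v : Fin n, s.arr 8 v = f v) (hf : ∀ v, f v ≤ n) (h9 : ∀ c, s.arr 9 c = z c)
    (hz : ∀ c, z c ≤ n) (h10 : ∀ c, s.arr 10 c = 0) (h16 : s.reg 16 ≤ 1) {R : ℕ}
    (hT : R + 10 * (adj x).length + 4 ≤ T) :
    Runs B (adjLoop 17 countNbr) s T fun T' s' => R ≤ T' ∧
      (∀ c, s'.arr 10 c = (adj x).countP fun v => f v = c) ∧ s'.reg 16 ≤ 1 ∧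
      (s'.reg 16 = 0 ↔ s.reg 16 = 0 ∨ ReachesSize f z (adj x)) := by
  refine Runs.adjLoop hin hB h17 h1 (by decide) (by decide) (by decide)
    (fun pre T' s' => R + 10 * ((adj x).length - pre.length) + 1 ≤ T' ∧
      (∀ c, s'.arr 10 c = pre.countP fun v => f v = c) ∧ s'.reg 16 ≤ 1 ∧
      (s'.reg 16 = 0 ↔ s.reg 16 = 0 ∨ ReachesSize f z pre)) ?_ ?_ ?_
  · refine ⟨by omega, fun i e j => ⟨by simp only [List.length_nil]; omega, ?_, ?_, ?_⟩⟩
    · simpa using h10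
    · simpa using h16
    · simp [ReachesSize]
  · rintro pre u post T' s' hadj hfr ⟨hT', hcount, h16', hflag⟩
    have hlen : (adj x).length = pre.length + (post.length + 1) := by rw [hadj]; simp
    have e1 : s'.reg 1 = 1 := by rw [hfr.reg 1 (by decide), h1]
    have e8 : s'.arr 8 u = f u := by rw [hfr.arr 8 (by decide), h8]
    have e9 : ∀ c, s'.arr 9 c = z c := fun c => by rw [hfr.arr 9 (by decide), h9]
    have hfu := hf u
    have hzu := hz (f u)
    have hcu : s'.arr 10 (f u) ≤ totalLength adj := by
      rw [hcount]
      refine List.countP_le_length.trans ?_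
      have : (adj x).length ≤ totalLength adj :=
        Finset.single_le_sum (f := fun v => (adj v).length) (fun _ _ => Nat.zero_le _)
          (Finset.mem_univ x)
      omega
    have hcount' : ∀ c, Function.update (s'.arr 10) (f u) (s'.arr 10 (f u) + 1) c =
        (pre ++ [u]).countP fun v => f v = c := by
      intro c
      rw [List.countP_append, ← hcount]
      by_cases hcf : c = f u
      · simp [hcf]
      · simp [hcf, Ne.symm hcf]
    have hmono : ∀ c, (pre.countP fun v => f v = c) ≤ (pre ++ [u]).countP fun v => f v = c :=
      fun c => by rw [List.countP_append]; omega
    have hsame : ∀ c, c ≠ f u →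
        ((pre ++ [u]).countP fun v => f v = c) = pre.countP fun v => f v = c := by
      intro c hc
      rw [List.countP_append]
      simp [Ne.symm hc]
    have hself : ((pre ++ [u]).countP fun v => f v = f u) = s'.arr 10 (f u) + 1 := by
      rw [← hcount', Function.update_self]
    refine ⟨by omega, ?_⟩
    simp only [countNbr, runs_seq, runs_assign, runs_cond, runs_store, runs_skip, Rhs.eval,
      Test.Holds, State.setReg_reg, State.setReg_arr, State.setArr_reg, State.setArr_arr, e1]
    simp only [reduceIte, Nat.reduceEqDiff, e8, e9]
    refine ⟨by omega, by omega, by omega, by omega, by omega, by omega, by omega, by omega,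
      by omega, by omega, by omega, fun hb => ⟨by omega, fun i => ⟨?_, hcount', h16', ?_⟩⟩,
      fun hb => ⟨by omega, by omega, fun i => ⟨?_, hcount', by omega, ?_⟩⟩⟩
    · simp only [List.length_append, List.length_singleton]; omega
    · rw [hflag]
      refine or_congr Iff.rfl ⟨?_, ?_⟩
      · rintro ⟨y, hy, hle⟩
        exact ⟨y, by simp [hy], hle.trans (hmono _)⟩
      · rintro ⟨y, hy, hle⟩
        have hyu : f y ≠ f u := by
          intro h
          rw [h, hself] at hle
          omega
        rw [hsame _ hyu] at hle
        rcases List.mem_append.1 hy with hy | hy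
        · exact ⟨y, hy, hle⟩
        · exact absurd (by simp [List.mem_singleton.1 hy]) hyu
    · simp only [List.length_append, List.length_singleton]; omega
    · simp only [true_iff]
      exact Or.inr ⟨u, by simp, by rw [hself]; omega⟩
  · rintro T' s' hfr ⟨hT', h⟩
    exact ⟨by omega, by omega, h⟩

theorem runs_resetNbrs {x : Fin n} {f : Fin n → ℕ} (hin : HasInput adj s)
    (hB : n + totalLength adj + 2 ≤ B) (h17 : s.reg 17 = x) (h1 : s.reg 1 = 1) (h2 : s.reg 2 = 0)
    (h8 : ∀ v : Fin n, s.arr 8 v = f v) (hf : ∀ v, f v ≤ n)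
    (h10 : ∀ c, c ∉ (adj x).map f → s.arr 10 c = 0) {R : ℕ}
    (hT : R + 5 * (adj x).length + 4 ≤ T) :
    Runs B (adjLoop 17 resetNbr) s T fun T' s' => R ≤ T' ∧ ∀ c, s'.arr 10 c = 0 := by
  refine Runs.adjLoop hin hB h17 h1 (by decide) (by decide) (by decide)
    (fun pre T' s' => R + 5 * ((adj x).length - pre.length) + 1 ≤ T' ∧
      ∀ c, c ∈ pre.map f ∨ c ∉ (adj x).map f → s'.arr 10 c = 0) ?_ ?_ ?_
  · refine ⟨by omega, fun i e j => ⟨by simp only [List.length_nil]; omega, ?_⟩⟩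
    intro c hc
    exact h10 c (hc.resolve_left (by simp))
  · rintro pre u post T' s' hadj hfr ⟨hT', hcount⟩
    have hlen : (adj x).length = pre.length + (post.length + 1) := by rw [hadj]; simp
    have e2 : s'.reg 2 = 0 := by rw [hfr.reg 2 (by decide), h2]
    have e8 : s'.arr 8 u = f u := by rw [hfr.arr 8 (by decide), h8]
    have hfu := hf u
    refine ⟨by omega, ?_⟩
    simp only [resetNbr, runs_seq, runs_assign, runs_store, Rhs.eval,
      State.setReg_reg, State.setReg_arr, State.setArr_arr, e2]
    simp only [reduceIte, Nat.reduceEqDiff, e8]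
    refine ⟨by omega, by omega, by omega, by omega, fun i => ⟨?_, fun c hc => ?_⟩⟩
    · simp only [List.length_append, List.length_singleton]; omega
    · by_cases hcf : c = f u
      · simp [hcf]
      · rw [Function.update_of_ne hcf]
        refine hcount c (hc.imp_left fun h => ?_)
        simpa [hcf] using h
  · rintro T' s' hfr ⟨hT', h⟩
    exact ⟨by omega, by omega, fun c => h c (em _)⟩

theorem runs_testLoop {f : Fin n → ℕ} {z : ℕ → ℕ} (hin : HasInput adj s)
    (hB : n + totalLength adj + 2 ≤ B) (h0 : s.reg 0 = n) (h1 : s.reg 1 = 1) (h2 : s.reg 2 = 0)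
    (h17 : s.reg 17 = 0) (h8 : ∀ v : Fin n, s.arr 8 v = f v) (hf : ∀ v, f v ≤ n)
    (h9 : ∀ c, s.arr 9 c = z c) (hz : ∀ c, z c ≤ n) (h10 : ∀ c, s.arr 10 c = 0)
    (h16 : s.reg 16 = 1) {R : ℕ}
    (hT : R + 12 * n + 15 * totalLength adj + 1 ≤ T) :
    Runs B testLoop s T fun T' s' => R ≤ T' ∧ s'.reg 16 ≤ 1 ∧
      (s'.reg 16 = 0 ↔ ∃ x, ReachesSize f z (adj x)) := by
  refine Runs.loop (fun T' s' => s'.reg 17 ≤ n ∧ (∀ c, s'.arr 10 c = 0) ∧ s'.reg 16 ≤ 1 ∧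
    (s'.reg 16 = 0 ↔ ReachesSizeBelow adj f z (s'.reg 17)) ∧
    R + 12 * n + 15 * totalLength adj + 1 ≤ T' + 12 * s'.reg 17 +
      15 * (((List.finRange n).take (s'.reg 17)).map fun v => (adj v).length).sum) ?_ ?_ ?_
  · simp [h17, h10, h16, ReachesSizeBelow]
    omega
  · rintro T' s' hfr ⟨hle, hc, h16', hflag, hT'⟩ hb
    have e0 : s'.reg 0 = n := by rw [hfr.reg 0 (by decide), h0]
    have e1 : s'.reg 1 = 1 := by rw [hfr.reg 1 (by decide), h1]
    have e2 : s'.reg 2 = 0 := by rw [hfr.reg 2 (by decide), h2]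
    simp only [Test.Holds, e0] at hb
    obtain ⟨x, hx⟩ : ∃ x : Fin n, s'.reg 17 = x := ⟨⟨_, hb⟩, rfl⟩
    have htake : (List.finRange n).take (x + 1) = (List.finRange n).take x ++ [x] := by
      rw [List.take_add_one]
      simp
    have hsum : (((List.finRange n).take x).map fun v => (adj v).length).sum + (adj x).length
        ≤ totalLength adj := by
      have := sum_length_le_totalLength (adj := adj) (l := (List.finRange n).take (x + 1))
        ((List.nodup_finRange n).sublist (List.take_sublist _ _))
      rw [htake] at this
      simpa using this
    rw [hx] at hT' hflag hb
    refine ⟨by omega, ?_⟩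
    simp only [runs_seq]
    refine (runs_countNbrs (x := x) (f := f) (z := z) (R := T' - 1 - (10 * (adj x).length + 4))
      (hin.congr (hfr.arr 0 (by decide)) (hfr.arr 1 (by decide))) hB hx e1 ?_ hf ?_ hz hc h16'
      (by omega)).mono ?_
    · intro v; rw [hfr.arr 8 (by decide), h8]
    · intro c; rw [hfr.arr 9 (by decide), h9]
    rintro T₁ s₁ hfr₁ ⟨hT₁, hcount₁, h16₁, hflag₁⟩
    have hin₁ : HasInput adj s₁ := hin.congr
      ((hfr₁.arr 0 (by decide)).trans (hfr.arr 0 (by decide)))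
      ((hfr₁.arr 1 (by decide)).trans (hfr.arr 1 (by decide)))
    refine (runs_resetNbrs (x := x) (f := f) (R := T₁ - (5 * (adj x).length + 4)) hin₁ hB ?_ ?_ ?_
      ?_ hf ?_ (by omega)).mono ?_
    · rw [hfr₁.reg 17 (by decide), hx]
    · rw [hfr₁.reg 1 (by decide), e1]
    · rw [hfr₁.reg 2 (by decide), e2]
    · intro v
      rw [hfr₁.arr 8 (by decide), hfr.arr 8 (by decide), h8]
    · intro c hcx
      rw [hcount₁, List.countP_eq_zero]
      intro v hv
      simp only [decide_eq_true_eq]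
      rintro rfl
      exact hcx (List.mem_map_of_mem hv)
    rintro T₂ s₂ hfr₂ ⟨hT₂, hc₂⟩
    have e17 : s₂.reg 17 = x := by
      rw [hfr₂.reg 17 (by decide), hfr₁.reg 17 (by decide), hx]
    have e1₂ : s₂.reg 1 = 1 := by
      rw [hfr₂.reg 1 (by decide), hfr₁.reg 1 (by decide), e1]
    have e16 : s₂.reg 16 = s₁.reg 16 := hfr₂.reg 16 (by decide)
    simp only [runs_assign, Rhs.eval, State.setReg_reg, State.setReg_arr, e17, e1₂]
    simp only [reduceIte, Nat.reduceEqDiff, e16, htake, List.map_append, List.sum_append,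
      List.map_cons, List.map_nil, List.sum_singleton]
    refine ⟨by omega, by omega, by omega, hc₂, h16₁, ?_, by omega⟩
    rw [hflag₁, hflag]
    constructor
    · rintro (⟨y, hy, h⟩ | h)
      · exact ⟨y, by omega, h⟩
      · exact ⟨x, by omega, h⟩
    · rintro ⟨y, hy, h⟩
      rcases Nat.lt_or_ge y x with hyx | hyx
      · exact Or.inl ⟨y, hyx, h⟩
      · obtain rfl : y = x := Fin.ext (by omega)
        exact Or.inr h
  · rintro T' s' hfr ⟨hle, hc, h16', hflag, hT'⟩ hb
    have e0 : s'.reg 0 = n := by rw [hfr.reg 0 (by decide), h0]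
    simp only [Test.Holds, e0] at hb
    obtain h17' : s'.reg 17 = n := by omega
    have hsum := sum_length_le_totalLength (adj := adj) (l := (List.finRange n).take n)
        ((List.nodup_finRange n).sublist (List.take_sublist _ _))
    rw [h17'] at hT' hflag
    refine ⟨by omega, by omega, h16', ?_⟩
    rw [hflag]
    exact exists_congr fun x => and_iff_right x.2

end RAM

namespace RAM

variable {B : ℕ} {s : State} {T : ℕ} {Q : ℕ → State → Prop}
variable {n : ℕ} {adj : Fin n → List (Fin n)} {G : SimpleGraph (Fin n)}

/-- The cells `1, …, N`, each with a value and the number of the next cell, contain the list `l`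
starting at cell `e`; the number `0` stands for the empty list. -/
inductive Chain (val nxt : ℕ → ℕ) (N : ℕ) : ℕ → List (Fin n) → Prop
  | nil : Chain val nxt N 0 []
  | cons {e : ℕ} {v : Fin n} {l : List (Fin n)} (h0 : 0 < e) (hN : e ≤ N) (hv : val e = v)
      (h : Chain val nxt N (nxt e) l) : Chain val nxt N e (v :: l)

theorem Chain.le {val nxt : ℕ → ℕ} {N e : ℕ} {l : List (Fin n)} (h : Chain val nxt N e l) :
    e ≤ N := by
  cases h with
  | nil => omega
  | cons _ h _ _ => exact h

theorem Chain.eq_zero {val nxt : ℕ → ℕ} {N e : ℕ}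
    (h : Chain val nxt N e ([] : List (Fin n))) : e = 0 := by
  cases h
  rfl

theorem Chain.of_cons {val nxt : ℕ → ℕ} {N e : ℕ} {v : Fin n} {l : List (Fin n)}
    (h : Chain val nxt N e (v :: l)) : 0 < e ∧ val e = v ∧ Chain val nxt N (nxt e) l := by
  cases h with
  | cons h0 _ hv h => exact ⟨h0, hv, h⟩

theorem Chain.update {val nxt : ℕ → ℕ} {N e : ℕ} {l : List (Fin n)} (h : Chain val nxt N e l)
    (a b : ℕ) :
    Chain (Function.update val (N + 1) a) (Function.update nxt (N + 1) b) (N + 1) e l := by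
  induction h with
  | nil => exact .nil
  | cons h0 hN hv _ ih =>
    refine .cons h0 (by omega) ?_ ?_
    · rw [Function.update_of_ne (by omega), hv]
    · rwa [Function.update_of_ne (by omega)]

theorem Chain.push {val nxt : ℕ → ℕ} {N e : ℕ} {l : List (Fin n)} (h : Chain val nxt N e l)
    (u : Fin n) :
    Chain (Function.update val (N + 1) u) (Function.update nxt (N + 1) e) (N + 1) (N + 1)
      (u :: l) := by
  refine .cons (by omega) le_rfl (by simp) ?_
  rw [Function.update_self]
  exact h.update _ _

/-- Write a list of all vertices into the cells `1, …, n` and make it the stack with number `0`.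
The values are in array `2`, the numbers of the next cells in array `3`, and the first cells of
the stacks in array `4`. Register `10` holds the number of cells in use. -/
def initLoop : Prog :=
  .seq (.loop (.lt 10 0) <|
    .seq (.assign 11 (.add 10 1)) <|
    .seq (.store 2 11 10) <|
    .seq (.store 3 11 10) <|
    .assign 10 (.copy 11)) <|
  .store 4 2 0

theorem runs_initLoop (hB : n + 2 ≤ B) (h0 : s.reg 0 = n) (h1 : s.reg 1 = 1) (h2 : s.reg 2 = 0)
    (h10 : s.reg 10 = 0) {R : ℕ} (hT : R + 5 * n + 2 ≤ T) :
    Runs B initLoop s T fun T' s' => R ≤ T' ∧ s'.reg 10 = n ∧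
      s'.arr 4 = Function.update (s.arr 4) 0 n ∧ ∃ l : List (Fin n), l.length = n ∧ (∀ v, v ∈ l) ∧
        Chain (s'.arr 2) (s'.arr 3) n n l := by
  rw [initLoop, runs_seq]
  refine Runs.loop (fun T' s' => s'.reg 10 ≤ n ∧ R + 5 * (n - s'.reg 10) + 2 ≤ T' ∧
    ∃ l : List (Fin n), l.length = s'.reg 10 ∧ (∀ v : Fin n, v < s'.reg 10 → v ∈ l) ∧
      Chain (s'.arr 2) (s'.arr 3) (s'.reg 10) (s'.reg 10) l) ?_ ?_ ?_
  · refine ⟨by omega, by omega, [], by simp [h10], by simp [h10], ?_⟩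
    rw [h10]
    exact .nil
  · rintro T' s' hfr ⟨hle, hT', l, hl, hmem, hch⟩ hb
    have e0 : s'.reg 0 = n := by rw [hfr.reg 0 (by decide), h0]
    have e1 : s'.reg 1 = 1 := by rw [hfr.reg 1 (by decide), h1]
    simp only [Test.Holds, e0] at hb
    refine ⟨by omega, ?_⟩
    simp only [runs_seq, runs_assign, runs_store, Rhs.eval,
      State.setReg_reg, State.setReg_arr, State.setArr_reg, State.setArr_arr, e1]
    simp only [reduceIte, Nat.reduceEqDiff]
    refine ⟨by omega, by omega, by omega, by omega, by omega, by omega, by omega, by omega,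
      by omega, by omega, ⟨s'.reg 10, hb⟩ :: l, by simp [hl], fun v hv => ?_, ?_⟩
    · rcases Nat.lt_or_ge v (s'.reg 10) with h | h
      · exact List.mem_cons_of_mem _ (hmem v h)
      · have : v = ⟨s'.reg 10, hb⟩ := Fin.ext (by simp only; omega)
        simp [this]
    · exact hch.push ⟨s'.reg 10, hb⟩
  · rintro T' s' hfr ⟨hle, hT', l, hl, hmem, hch⟩ hb
    have e0 : s'.reg 0 = n := by rw [hfr.reg 0 (by decide), h0]
    have e2 : s'.reg 2 = 0 := by rw [hfr.reg 2 (by decide), h2]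
    simp only [Test.Holds, e0] at hb
    have e10 : s'.reg 10 = n := by omega
    rw [e10] at hl hmem hch
    simp only [runs_store, State.setArr_reg, State.setArr_arr, e0, e2, hfr.arr 4 (by decide)]
    exact ⟨by omega, by omega, by omega, by omega, e10, by simp, l, hl, fun v => hmem v v.2,
      by simpa using hch⟩

/-- The state of a search after the vertices of `o` have been visited: array `6` marks the visited
vertices, array `5` holds the labels `ℓ` of the others, and `L j` is the content of the stack with
number `j`. -/
structure SearchState (o : List (Fin n)) (ℓ : Fin n → ℕ) (L : ℕ → List (Fin n)) (s : State) :
    Prop where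
  visited : ∀ v : Fin n, s.arr 6 v = if v ∈ o then 1 else 0
  label : ∀ v : Fin n, v ∉ o → s.arr 5 v = ℓ v
  chain : ∀ j, Chain (s.arr 2) (s.arr 3) (s.reg 10) (s.arr 4 j) (L j)
  mem : ∀ v, v ∉ o → v ∈ L (ℓ v)
  le : ∀ j, ∀ v ∈ L j, v ∉ o → j ≤ ℓ v

theorem SearchState.congr {o : List (Fin n)} {ℓ ℓ' : Fin n → ℕ} {L : ℕ → List (Fin n)}
    {s s' : State} (h : SearchState o ℓ L s) (ha : s'.arr = s.arr) (hr : s'.reg 10 = s.reg 10)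
    (hℓ : ∀ v, v ∉ o → ℓ' v = ℓ v) : SearchState o ℓ' L s' := by
  refine ⟨?_, ?_, ?_, ?_, ?_⟩
  · rw [ha]; exact h.visited
  · intro v hv; rw [ha, hℓ v hv]; exact h.label v hv
  · rw [ha, hr]; exact h.chain
  · intro v hv; rw [hℓ v hv]; exact h.mem v hv
  · intro j v hj hv; rw [hℓ v hv]; exact h.le j v hj hv

/-- The number of entries of the stacks `0, …, n`. -/
def stackSize (L : ℕ → List (Fin n)) : ℕ := ∑ j ∈ Finset.range (n + 1), (L j).length

theorem stackSize_push (L : ℕ → List (Fin n)) (j : ℕ) (u : Fin n) :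
    stackSize (Function.update L j (u :: L j)) ≤ stackSize L + 1 := by
  by_cases hj : j ∈ Finset.range (n + 1)
  · rw [stackSize, stackSize, ← Finset.add_sum_erase _ _ hj, ← Finset.add_sum_erase _ _ hj,
      Function.update_self, List.length_cons]
    have : ∑ x ∈ (Finset.range (n + 1)).erase j, (Function.update L j (u :: L j) x).length =
        ∑ x ∈ (Finset.range (n + 1)).erase j, (L x).length :=
      Finset.sum_congr rfl fun x hx => by rw [Function.update_of_ne (Finset.ne_of_mem_erase hx)]
    omega
  · rw [stackSize, stackSize]
    have : ∑ x ∈ Finset.range (n + 1), (Function.update L j (u :: L j) x).length =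
        ∑ x ∈ Finset.range (n + 1), (L x).length :=
      Finset.sum_congr rfl fun x hx => by
        rw [Function.update_of_ne (by rintro rfl; exact hj hx)]
    omega

theorem stackSize_pop {L : ℕ → List (Fin n)} {j : ℕ} {v : Fin n} {l : List (Fin n)} (hj : j ≤ n)
    (hL : L j = v :: l) : stackSize (Function.update L j l) + 1 = stackSize L := by
  have hj' : j ∈ Finset.range (n + 1) := Finset.mem_range.2 (by omega)
  rw [stackSize, stackSize, ← Finset.add_sum_erase _ _ hj', ← Finset.add_sum_erase _ _ hj',
    Function.update_self, hL, List.length_cons]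
  have : ∑ x ∈ (Finset.range (n + 1)).erase j, (Function.update L j l x).length =
      ∑ x ∈ (Finset.range (n + 1)).erase j, (L x).length :=
    Finset.sum_congr rfl fun x hx => by rw [Function.update_of_ne (Finset.ne_of_mem_erase hx)]
  omega

/-- Unless it is visited, raise the label of the vertex in register `6` and push the vertex onto
the stack of its new label. -/
def pushNbr : Prog :=
  .seq (.assign 13 (.load 6 6)) <|
  .cond (.eq 13 2)
    (.seq (.assign 14 (.load 5 6)) <|
     .seq (.assign 14 (.add 14 1)) <|
     .seq (.store 5 6 14) <|
     .seq (.assign 15 (.load 4 14)) <|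
     .seq (.assign 10 (.add 10 1)) <|
     .seq (.store 2 10 6) <|
     .seq (.store 3 10 15) <|
     .store 4 14 10)
    .skip

theorem runs_pushNbrs {x : Fin n} {o : List (Fin n)} {ℓ : Fin n → ℕ} {L : ℕ → List (Fin n)}
    (hin : HasInput adj s) (hnd : (adj x).Nodup) (hB : 2 * n + totalLength adj + 2 ≤ B)
    (h12 : s.reg 12 = x) (h1 : s.reg 1 = 1) (h2 : s.reg 2 = 0) (hS : SearchState o ℓ L s)
    (hℓ : ∀ v, v ∉ o → ℓ v ≤ n) (h10 : s.reg 10 + (adj x).length ≤ n + totalLength adj) {R : ℕ}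
    (hT : R + 10 * stackSize L + 23 * (adj x).length + 4 ≤ T) :
    Runs B (adjLoop 12 pushNbr) s T fun T' s' => ∃ L', R + 10 * stackSize L' ≤ T' ∧
      s'.reg 10 ≤ s.reg 10 + (adj x).length ∧
      SearchState o (fun v => ℓ v + if v ∈ adj x then 1 else 0) L' s' := by
  refine Runs.adjLoop hin (by omega) h12 h1 (by decide) (by decide) (by decide)
    (fun pre T' s' => ∃ L',
      R + 10 * stackSize L' + 23 * ((adj x).length - pre.length) + 1 ≤ T' ∧
      s'.reg 10 ≤ s.reg 10 + pre.length ∧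
      SearchState o (fun v => ℓ v + if v ∈ pre then 1 else 0) L' s') ?_ ?_ ?_
  · refine ⟨by omega, fun i e j => ⟨L, ?_, ?_, ?_⟩⟩
    · simp only [List.length_nil]; omega
    · simp
    · exact hS.congr rfl (by simp) (by simp)
  · rintro pre u post T' s' hadj hfr ⟨L', hT', h10', hS'⟩
    have hlen : (adj x).length = pre.length + (post.length + 1) := by rw [hadj]; simp
    have hupre : u ∉ pre := by
      intro h
      rw [hadj, List.nodup_append] at hnd
      exact hnd.2.2 u h u (by simp) rfl
    have e1 : s'.reg 1 = 1 := by rw [hfr.reg 1 (by decide), h1]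
    have e2 : s'.reg 2 = 0 := by rw [hfr.reg 2 (by decide), h2]
    have hu := u.2
    have h6 : s'.arr 6 u ≤ 1 := by rw [hS'.visited]; split_ifs <;> omega
    refine ⟨by omega, ?_⟩
    simp only [pushNbr, runs_seq, runs_assign, runs_cond, runs_store, runs_skip, Rhs.eval,
      Test.Holds, State.setReg_reg, State.setReg_arr, State.setArr_reg, State.setArr_arr, e1, e2]
    simp only [reduceIte, Nat.reduceEqDiff]
    refine ⟨by omega, by omega, by omega, fun hb => ?_, fun hb => ⟨by omega, fun i => ?_⟩⟩
    · have huo : u ∉ o := by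
        intro h
        rw [hS'.visited, if_pos h] at hb
        omega
      have e5 : s'.arr 5 u = ℓ u := by
        rw [hS'.label u huo]
        simp [hupre]
      have hℓu := hℓ u huo
      have hch := hS'.chain (ℓ u + 1)
      have hchle := hch.le
      simp only [e5]
      refine ⟨by omega, by omega, by omega, by omega, by omega, by omega, by omega, by omega,
        by omega, by omega, by omega, by omega, by omega, by omega, by omega, by omega,
        fun i => ⟨Function.update L' (ℓ u + 1) (u :: L' (ℓ u + 1)), ?_, ?_, ?_⟩⟩
      · have := stackSize_push L' (ℓ u + 1) u
        simp only [List.length_append, List.length_singleton]; omega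
      · simp only [List.length_append, List.length_singleton]; omega
      · refine ⟨?_, ?_, ?_, ?_, ?_⟩
        · simpa using hS'.visited
        · intro v hv
          by_cases hvu : v = u
          · simp [hvu]
          · have hvu' : (v : ℕ) ≠ u := fun h => hvu (Fin.ext h)
            simpa [hvu, hvu'] using hS'.label v hv
        · intro j
          by_cases hj : j = ℓ u + 1
          · simpa [hj] using hch.push u
          · simpa [hj] using (hS'.chain j).update _ _
        · intro v hv
          by_cases hvu : v = u
          · simp [hvu]
          · have := hS'.mem v hv
            simp only [List.mem_append, List.mem_singleton, hvu, or_false]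
            generalize (ℓ v + if v ∈ pre then 1 else 0) = j at *
            by_cases hj : j = ℓ u + 1
            · subst hj; simp [this]
            · simpa [hj] using this
        · intro j v hj hv
          have hmem : v ∈ L' j ∨ (j = ℓ u + 1 ∧ v = u) := by
            by_cases hju : j = ℓ u + 1
            · subst hju
              simp only [Function.update_self, List.mem_cons] at hj
              tauto
            · rw [Function.update_of_ne hju] at hj
              exact Or.inl hj
          rcases hmem with h | ⟨rfl, rfl⟩
          · refine (hS'.le j v h hv).trans ?_
            simp only [List.mem_append]
            split_ifs <;> first | omega | tauto
          · simp
    · have huo : u ∈ o := by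
        by_contra h
        rw [hS'.visited, if_neg h] at hb
        omega
      refine ⟨L', ?_, ?_, ?_⟩
      · simp only [List.length_append, List.length_singleton]; omega
      · simp only [List.length_append, List.length_singleton]; omega
      · refine hS'.congr rfl (by simp) fun v hv => ?_
        have : v ≠ u := by rintro rfl; exact hv huo
        simp [this]
  · rintro T' s' hfr ⟨L', hT', h10', hS'⟩
    exact ⟨by omega, L', by omega, h10', hS'⟩

/-- Maximum cardinality search, with the visited vertices written into array `7`. Register `7`
holds their number, and register `8` a bound for the labels of the other vertices. -/
def searchLoop : Prog :=
  .loop (.lt 7 0) <|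
  .seq (.assign 9 (.load 4 8)) <|
  .cond (.eq 9 2)
    (.assign 8 (.sub 8 1))
    (.seq (.assign 11 (.load 3 9)) <|
     .seq (.store 4 8 11) <|
     .seq (.assign 12 (.load 2 9)) <|
     .seq (.assign 13 (.load 6 12)) <|
     .cond (.eq 13 2)
       (.seq (.store 6 12 1) <|
        .seq (.store 7 7 12) <|
        .seq (.assign 7 (.add 7 1)) <|
        .seq (adjLoop 12 pushNbr) <|
        .assign 8 (.add 8 1))
       .skip)

theorem runs_searchLoop (hin : HasInput adj s) (hG : IsAdjList G adj)
    (hB : 2 * n + totalLength adj + 2 ≤ B) (h0 : s.reg 0 = n) (h1 : s.reg 1 = 1)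
    (h2 : s.reg 2 = 0) (h7 : s.reg 7 = 0) (h8 : s.reg 8 = 0) (h10 : s.reg 10 = n)
    {L : ℕ → List (Fin n)} (hS : SearchState [] (fun _ => 0) L s) {R : ℕ}
    (hT : R + 10 * stackSize L + 30 * n + 23 * totalLength adj + 1 ≤ T) :
    Runs B searchLoop s T fun T' s' => R ≤ T' ∧ ∃ o, G.IsMaxCardSearch o ∧ o.length = n ∧
      s'.reg 7 = o.length ∧ ∀ i (h : i < o.length), s'.arr 7 i = o[i] := by
  classical
  refine Runs.loop (fun T' s' => ∃ o L, G.IsMaxCardSearch o ∧ SearchState o (G.nbrCount o) L s' ∧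
    s'.reg 7 = o.length ∧ (∀ i (h : i < o.length), s'.arr 7 i = o[i]) ∧
    (∀ v, v ∉ o → G.nbrCount o v ≤ s'.reg 8) ∧ s'.reg 8 ≤ o.length ∧
    s'.reg 10 ≤ n + (o.map fun v => (adj v).length).sum ∧
    R + 10 * stackSize L + 4 * s'.reg 8 + 30 * n + 23 * totalLength adj + 1 ≤
      T' + 30 * o.length + 23 * (o.map fun v => (adj v).length).sum) ?_ ?_ ?_
  · refine ⟨[], L, .nil, hS.congr rfl rfl (by simp), by simp [h7], by simp, by simp, by simp [h8],
      by simp [h10], ?_⟩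
    simp only [h8, List.length_nil, List.map_nil, List.sum_nil]
    omega
  · rintro T' s' hfr ⟨o, L, ho, hS', h7', hord, hlab, h8', h10', hT'⟩ hb
    have e0 : s'.reg 0 = n := by rw [hfr.reg 0 (by decide), h0]
    have e1 : s'.reg 1 = 1 := by rw [hfr.reg 1 (by decide), h1]
    have e2 : s'.reg 2 = 0 := by rw [hfr.reg 2 (by decide), h2]
    simp only [Test.Holds, e0, h7'] at hb
    have hsum := sum_length_le_totalLength (adj := adj) ho.nodup
    have hch := hS'.chain (s'.reg 8)
    have hchle := hch.le
    refine ⟨by omega, ?_⟩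
    simp only [runs_seq, runs_assign, runs_cond, Rhs.eval,
      Test.Holds, State.setReg_reg, State.setReg_arr, e1, e2]
    simp only [reduceIte, Nat.reduceEqDiff]
    refine ⟨by omega, by omega, by omega, fun hb => ⟨by omega, by omega, ?_⟩, fun hb => ?_⟩
    · have hnil : L (s'.reg 8) = [] := by
        rw [hb] at hch
        cases hLe : L (s'.reg 8) with
        | nil => rfl
        | cons v l =>
          rw [hLe] at hch
          exact absurd hch.of_cons.1 (by omega)
      have hlt : ∀ v, v ∉ o → G.nbrCount o v < s'.reg 8 := by
        intro v hv
        refine lt_of_le_of_ne (hlab v hv) fun h => ?_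
        have := hS'.mem v hv
        rw [h, hnil] at this
        simp at this
      have hpos : 0 < s'.reg 8 := by
        obtain ⟨v, hv⟩ : ∃ v, v ∉ o := by
          by_contra hcon
          push Not at hcon
          have h := Finset.card_le_card (s := Finset.univ) (t := o.toFinset)
            fun v _ => List.mem_toFinset.2 (hcon v)
          rw [List.toFinset_card_of_nodup ho.nodup, Finset.card_univ, Fintype.card_fin] at h
          omega
        have := hlt v hv
        omega
      refine ⟨o, L, ho, hS'.congr rfl (by simp) fun _ _ => rfl, by simpa using h7', hord, ?_, ?_,
        ?_, ?_⟩
      · intro v hv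
        have := hlt v hv
        omega
      · omega
      · simpa using h10'
      · omega
    · obtain ⟨v, l, hL, hval, hch'⟩ : ∃ v l, L (s'.reg 8) = v :: l ∧
          s'.arr 2 (s'.arr 4 (s'.reg 8)) = v ∧
          Chain (s'.arr 2) (s'.arr 3) (s'.reg 10) (s'.arr 3 (s'.arr 4 (s'.reg 8))) l := by
        cases hLe : L (s'.reg 8) with
        | nil =>
          rw [hLe] at hch
          exact absurd hch.eq_zero hb
        | cons v l =>
          rw [hLe] at hch
          exact ⟨v, l, rfl, hch.of_cons.2⟩
      have hchle' := hch'.le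
      have hv := v.2
      have h6 : s'.arr 6 v ≤ 1 := by rw [hS'.visited]; split_ifs <;> omega
      have hpop := stackSize_pop (by omega) hL
      have hch₁ : ∀ j, Chain (s'.arr 2) (s'.arr 3) (s'.reg 10)
          (Function.update (s'.arr 4) (s'.reg 8) (s'.arr 3 (s'.arr 4 (s'.reg 8))) j)
          (Function.update L (s'.reg 8) l j) := by
        intro j
        by_cases hj : j = s'.reg 8
        · subst hj; simpa using hch'
        · simpa [hj] using hS'.chain j
      have hsub : ∀ j, ∀ w ∈ Function.update L (s'.reg 8) l j, w ∈ L j := by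
        intro j w hw
        by_cases hj : j = s'.reg 8
        · subst hj
          rw [Function.update_self] at hw
          rw [hL]
          exact List.mem_cons_of_mem _ hw
        · rwa [Function.update_of_ne hj] at hw
      have hmem₁ : ∀ w, w ∉ o → w ≠ v →
          w ∈ Function.update L (s'.reg 8) l (G.nbrCount o w) := by
        intro w hw hwv
        have := hS'.mem w hw
        by_cases hj : G.nbrCount o w = s'.reg 8
        · rw [hj, hL] at this
          rw [hj, Function.update_self]
          exact (List.mem_cons.1 this).resolve_left hwv
        · rwa [Function.update_of_ne hj]
      simp only [runs_store, runs_skip,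
        State.setReg_reg, State.setReg_arr, State.setArr_reg, State.setArr_arr, e1, e2]
      simp only [reduceIte, Nat.reduceEqDiff, hval]
      refine ⟨by omega, by omega, by omega, by omega, by omega, by omega, by omega, by omega,
        by omega, fun hb => ?_, fun hb => ⟨by omega, ?_⟩⟩
      · have hvo : v ∉ o := by
          intro h
          rw [hS'.visited, if_pos h] at hb
          omega
        have hmax : G.nbrCount o v = s'.reg 8 :=
          le_antisymm (hlab v hvo) (hS'.le _ v (by rw [hL]; simp) hvo)
        have ho' : G.IsMaxCardSearch (o ++ [v]) :=
          ho.concat hvo fun w hw => by rw [hmax]; exact hlab w hw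
        have hsum' := sum_length_le_totalLength (adj := adj) ho'.nodup
        simp only [List.map_append, List.sum_append, List.map_cons, List.map_nil,
          List.sum_singleton] at hsum'
        refine ⟨by omega, by omega, by omega, by omega, by omega, by omega, ?_⟩
        refine (runs_pushNbrs (x := v) (o := o ++ [v]) (ℓ := G.nbrCount o)
          (L := Function.update L (s'.reg 8) l)
          (R := T' - (13 + 10 * stackSize (Function.update L (s'.reg 8) l) +
            23 * (adj v).length + 2)) ?_ (hG v).1 hB ?_ ?_ ?_ ?_ ?_ ?_ ?_).mono ?_
        · refine hin.congr ?_ ?_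
          · simpa using hfr.arr 0 (by decide)
          · simpa using hfr.arr 1 (by decide)
        · simp
        · simp [e1]
        · simp [e2]
        · refine ⟨?_, ?_, ?_, ?_, ?_⟩
          · intro w
            by_cases hw : w = v
            · simp [hw]
            · have hw' : (w : ℕ) ≠ v := fun h => hw (Fin.ext h)
              simpa [hw, hw'] using hS'.visited w
          · intro w hw
            simp only [List.mem_append, not_or] at hw
            simpa using hS'.label w hw.1
          · simpa using hch₁
          · intro w hw
            simp only [List.mem_append, List.mem_singleton, not_or] at hw
            exact hmem₁ w hw.1 hw.2
          · intro j w hj hw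
            simp only [List.mem_append, not_or] at hw
            exact hS'.le j w (hsub j w hj) hw.1
        · intro w _
          refine (G.nbrCount_le_length o w).trans ?_
          omega
        · simp only [State.setReg_reg, State.setArr_reg, Nat.reduceEqDiff, reduceIte]
          omega
        · omega
        rintro T₁ s₁ hfr₁ ⟨L₁, hT₁, h10₁, hS₁⟩
        have e8 : s₁.reg 8 = s'.reg 8 := by rw [hfr₁.reg 8 (by decide)]; simp
        have e7 : s₁.reg 7 = o.length + 1 := by rw [hfr₁.reg 7 (by decide)]; simp [h7']
        have e1₁ : s₁.reg 1 = 1 := by rw [hfr₁.reg 1 (by decide)]; simp [e1]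
        have e7a : s₁.arr 7 = Function.update (s'.arr 7) o.length v := by
          rw [hfr₁.arr 7 (by decide)]; simp [h7']
        simp only [State.setReg_reg, State.setArr_reg, Nat.reduceEqDiff, reduceIte] at h10₁
        have hcount : ∀ w, G.nbrCount (o ++ [v]) w =
            G.nbrCount o w + if w ∈ adj v then 1 else 0 := by
          intro w
          rw [SimpleGraph.nbrCount_concat]
          simp only [(hG v).2, G.adj_comm]
        rw [e8, e1₁]
        refine ⟨by omega, by omega, o ++ [v], L₁, ho', hS₁.congr rfl (by simp)
          (fun w _ => hcount w), ?_, ?_, ?_, ?_, ?_, ?_⟩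
        · simp [e7]
        · intro i hi
          simp only [e7a]
          by_cases hio : i = o.length
          · subst hio; simp
          · have hi' : i < o.length := by simp at hi; omega
            rw [Function.update_of_ne hio, List.getElem_append_left hi']
            exact hord i hi'
        · intro w hw
          simp only [List.mem_append, not_or] at hw
          have := hlab w hw.1
          rw [hcount]
          split_ifs <;> omega
        · simp only [List.length_append, List.length_singleton]; omega
        · simp only [List.map_append,
            List.sum_append, List.map_cons, List.map_nil, List.sum_singleton]
          omega
        · simp only [List.map_append, List.length_append,
            List.length_singleton, List.sum_append, List.map_cons, List.map_nil,
            List.sum_singleton]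
          omega
      · have hvo : v ∈ o := by
          by_contra h
          rw [hS'.visited, if_neg h] at hb
          omega
        refine ⟨o, Function.update L (s'.reg 8) l, ho, ⟨?_, ?_, ?_, ?_, ?_⟩, by simpa using h7', ?_,
          ?_, ?_, ?_, ?_⟩
        · simpa using hS'.visited
        · simpa using hS'.label
        · simpa using hch₁
        · exact fun w hw => hmem₁ w hw (by rintro rfl; exact hw hvo)
        · exact fun j w hj hw => hS'.le j w (hsub j w hj) hw
        · simpa using hord
        · simpa using hlab
        · simpa using h8'
        · simpa using h10'
        · omega
  · rintro T' s' hfr ⟨o, L, ho, hS', h7', hord, hlab, h8', h10', hT'⟩ hb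
    have e0 : s'.reg 0 = n := by rw [hfr.reg 0 (by decide), h0]
    simp only [Test.Holds, e0, h7'] at hb
    have hle : o.length ≤ n := by
      have := ho.nodup.length_le_card
      simpa using this
    have hsum := sum_length_le_totalLength (adj := adj) ho.nodup
    exact ⟨by omega, by omega, o, ho, by omega, h7', hord⟩

end RAM

namespace RAM

variable {n : ℕ} {adj : Fin n → List (Fin n)} {G : SimpleGraph (Fin n)}

theorem IsAdjList.totalLength_eq (h : IsAdjList G adj) :
    totalLength adj = 2 * G.edgeSet.ncard := by
  classical
  have hdeg : ∀ v, (adj v).length = G.degree v := by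
    intro v
    rw [← List.toFinset_card_of_nodup (h v).1, ← SimpleGraph.card_neighborFinset_eq_degree]
    congr 1
    ext u
    simp [(h v).2]
  rw [totalLength, Finset.sum_congr rfl fun v _ => hdeg v, G.sum_degrees_eq_twice_card_edges,
    ← SimpleGraph.coe_edgeFinset, Set.ncard_coe_finset]

theorem IsAdjList.reachesSize_iff (h : IsAdjList G adj) (f : Fin n → ℕ) (x : Fin n) :
    ReachesSize f (fun c => (List.finRange n).countP fun v => f v = c) (adj x) ↔
      ∃ w, ∀ u, f u = f w → G.Adj x u := by
  have hcard : ∀ (l : List (Fin n)) (c : ℕ), l.Nodup →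
      (l.countP fun v => f v = c) = (l.toFinset.filter fun v => f v = c).card := by
    intro l c hl
    rw [List.countP_eq_length_filter, ← List.toFinset_card_of_nodup (hl.filter _),
      List.toFinset_filter]
    simp
  have huniv : (List.finRange n).toFinset = Finset.univ := by ext; simp
  have hsub : ∀ c, ((adj x).toFinset.filter fun v => f v = c) ⊆
      (Finset.univ.filter fun v => f v = c) :=
    fun c => Finset.filter_subset_filter _ (Finset.subset_univ _)
  have key : ∀ c, ((List.finRange n).countP fun v => f v = c) ≤
      ((adj x).countP fun v => f v = c) ↔ ∀ u, f u = c → G.Adj x u := by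
    intro c
    rw [hcard _ _ (List.nodup_finRange n), hcard _ _ (h x).1, huniv]
    constructor
    · intro hle u hu
      have := Finset.eq_of_subset_of_card_le (hsub c) hle
      have hu' : u ∈ Finset.univ.filter fun v => f v = c := by simp [hu]
      rw [← this] at hu'
      exact ((h x).2 u).1 (List.mem_toFinset.1 (Finset.mem_filter.1 hu').1)
    · intro hall
      refine Finset.card_le_card fun u hu => ?_
      have hu' := (Finset.mem_filter.1 hu).2
      exact Finset.mem_filter.2 ⟨List.mem_toFinset.2 (((h x).2 u).2 (hall u hu')), hu'⟩
  constructor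
  · rintro ⟨w, -, hw⟩
    exact ⟨w, (key (f w)).1 hw⟩
  · rintro ⟨w, hw⟩
    exact ⟨w, ((h x).2 w).2 (hw w rfl), (key (f w)).2 hw⟩

/-- The test of 1-extendability for chordal graphs. -/
def extendableProg : Prog :=
  .seq (.assign 1 (.const 1)) <|
  .seq initLoop <|
  .seq searchLoop <|
  .seq coverLoop <|
  .seq sizeLoop <|
  .seq (.assign 16 (.const 1)) <|
  .seq testLoop <|
  .assign 0 (.copy 16)

theorem runs_extendableProg (hG : G.IsChordal) (hadj : IsAdjList G adj) {B T : ℕ}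
    (hB : 2 * n + totalLength adj + 2 ≤ B) (hT : 75 * n + 44 * totalLength adj + 10 ≤ T) :
    Runs B extendableProg (inputState adj) T fun _ s =>
      s.reg 0 ≤ 1 ∧ (s.reg 0 = 0 ↔ ¬ G.IsExtendable 1) := by
  have hreg : ∀ x, (inputState adj).reg x = if x = 0 then n else 0 := fun _ => rfl
  have harr : ∀ a i, 2 ≤ a → (inputState adj).arr a i = 0 := by
    intro a i ha
    simp [inputState, show a ≠ 0 by omega, show a ≠ 1 by omega]
  have hin₀ : HasInput adj (inputState adj) := ⟨rfl, rfl⟩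
  generalize inputState adj = s₀ at *
  simp only [extendableProg, runs_seq, runs_assign, Rhs.eval]
  refine ⟨by omega, by omega, ?_⟩
  refine (runs_initLoop (n := n) (R := T - 1 - (5 * n + 2)) (by omega) (by simp [hreg]) (by simp)
    (by simp [hreg]) (by simp [hreg]) (by omega)).mono ?_
  rintro T₁ s₁ hf₁ ⟨hT₁, h10₁, h4₁, l, hl, hlmem, hch⟩
  have e0₁ : s₁.reg 0 = n := by rw [hf₁.reg 0 (by decide)]; simp [hreg]
  have e1₁ : s₁.reg 1 = 1 := by rw [hf₁.reg 1 (by decide)]; simp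
  have er₁ : ∀ r, r ∉ [0, 1, 10, 11] → s₁.reg r = 0 := by
    intro r hr
    simp only [List.mem_cons, List.not_mem_nil, or_false, not_or] at hr
    rw [hf₁.reg r (by simp [initLoop, Prog.regs, hr.2.2.1, hr.2.2.2])]
    simp [hreg, hr.1, hr.2.1]
  have ea₁ : ∀ a, 4 < a → ∀ i, s₁.arr a i = 0 := by
    intro a ha i
    rw [hf₁.arr a (by simp [initLoop, Prog.arrs]; omega)]
    exact harr a i (by omega)
  have hin₁ : HasInput adj s₁ := hin₀.congr (hf₁.arr 0 (by decide)) (hf₁.arr 1 (by decide))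
  have hsize : stackSize (Function.update (fun _ => []) 0 l) ≤ n := by
    rw [stackSize, Finset.sum_eq_single 0]
    · simp [hl]
    · intro j _ hj; simp [hj]
    · simp
  refine (runs_searchLoop (G := G) (L := Function.update (fun _ => []) 0 l)
    (R := T₁ - (40 * n + 23 * totalLength adj + 1)) hin₁ hadj hB e0₁ e1₁
    (er₁ 2 (by decide)) (er₁ 7 (by decide)) (er₁ 8 (by decide)) h10₁ ?_ (by omega)).mono ?_
  · refine ⟨?_, ?_, ?_, ?_, ?_⟩
    · intro v; simp [ea₁ 6 (by omega)]
    · intro v _; exact ea₁ 5 (by omega) v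
    · intro j
      rw [h4₁, h10₁]
      by_cases hj : j = 0
      · simpa [hj] using hch
      · simp only [Function.update_of_ne hj, State.setReg_arr, harr 4 j (by omega)]
        exact .nil
    · intro v _; simpa using hlmem v
    · intro j v hv _
      by_contra hj
      rw [Function.update_of_ne (by omega)] at hv
      simp at hv
  rintro T₂ s₂ hf₂ ⟨hT₂, o, ho, holen, h7₂, hord⟩
  have hall : ∀ v, v ∈ o := by
    have : o.toFinset = Finset.univ := by
      apply Finset.eq_univ_of_card
      rw [List.toFinset_card_of_nodup ho.nodup, holen, Fintype.card_fin]
    intro v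
    rw [← List.mem_toFinset, this]
    exact Finset.mem_univ v
  obtain ⟨c, hc, hcover⟩ := hG.exists_isCliqueCover ho hall
  have e0₂ : s₂.reg 0 = n := by rw [hf₂.reg 0 (by decide), e0₁]
  have e1₂ : s₂.reg 1 = 1 := by rw [hf₂.reg 1 (by decide), e1₁]
  have e2₂ : s₂.reg 2 = 0 := by rw [hf₂.reg 2 (by decide), er₁ 2 (by decide)]
  have hin₂ : HasInput adj s₂ := hin₁.congr (hf₂.arr 0 (by decide)) (hf₂.arr 1 (by decide))
  have hosum := sum_length_le_totalLength (adj := adj) ho.nodup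
  refine (runs_coverLoop (G := G) (o := o) (R := T₂ - (12 * n + 6 * totalLength adj + 1)) hin₂ hadj
    (by omega) h7₂ e1₂ e2₂ holen.le hord ?_ (by omega)).mono ?_
  · intro v
    rw [hf₂.arr 8 (by decide)]
    exact ea₁ 8 (by omega) v
  rintro T₃ s₃ hf₃ ⟨hT₃, h7₃, h8₃⟩
  replace h8₃ : ∀ v : Fin n, s₃.arr 8 v = c v + 1 := by
    intro v
    rw [h8₃, hcover]
    rfl
  have e0₃ : s₃.reg 0 = n := by rw [hf₃.reg 0 (by decide), e0₂]
  have e1₃ : s₃.reg 1 = 1 := by rw [hf₃.reg 1 (by decide), e1₂]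
  have e2₃ : s₃.reg 2 = 0 := by rw [hf₃.reg 2 (by decide), e2₂]
  have hin₃ : HasInput adj s₃ := hin₂.congr (hf₃.arr 0 (by decide)) (hf₃.arr 1 (by decide))
  have hcn : ∀ v, (c v : ℕ) + 1 ≤ n := fun v => (c v).2
  refine (runs_sizeLoop (f := fun v => c v + 1) (R := T₃ - (6 * n + 1)) (by omega) e0₃ e1₃ h7₃ h8₃
    hcn ?_ (by omega)).mono ?_
  · intro i
    rw [hf₃.arr 9 (by decide), hf₂.arr 9 (by decide)]
    exact ea₁ 9 (by omega) i
  rintro T₄ s₄ hf₄ ⟨hT₄, h9₄⟩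
  refine ⟨by omega, by omega, ?_⟩
  have hin₄ : HasInput adj (s₄.setReg 16 1) :=
    hin₃.congr (hf₄.arr 0 (by decide)) (hf₄.arr 1 (by decide))
  refine (runs_testLoop (f := fun v => c v + 1)
    (z := fun k => (List.finRange n).countP fun v => (c v : ℕ) + 1 = k)
    (R := T₄ - 1 - (12 * n + 15 * totalLength adj + 1)) hin₄ (by omega) ?_ ?_ ?_ ?_ ?_ hcn
    (by simpa using h9₄) ?_ ?_ (by simp) (by omega)).mono ?_
  · simpa using (hf₄.reg 0 (by decide)).trans e0₃
  · simpa using (hf₄.reg 1 (by decide)).trans e1₃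
  · simpa using (hf₄.reg 2 (by decide)).trans e2₃
  · simp only [State.setReg_reg, Nat.reduceEqDiff, if_false]
    rw [hf₄.reg 17 (by decide), hf₃.reg 17 (by decide), hf₂.reg 17 (by decide)]
    exact er₁ 17 (by decide)
  · intro v
    rw [State.setReg_arr, hf₄.arr 8 (by decide), h8₃]
  · intro k
    exact List.countP_le_length.trans (by simp)
  · intro i
    rw [State.setReg_arr, hf₄.arr 10 (by decide), hf₃.arr 10 (by decide), hf₂.arr 10 (by decide)]
    exact ea₁ 10 (by omega) i
  rintro T₅ s₅ hf₅ ⟨hT₅, h16, hflag⟩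
  refine ⟨by clear hflag; omega, by clear hflag; omega, by simpa using h16, ?_⟩
  simp only [State.setReg_reg, if_true]
  rw [hflag, hc.isExtendable_iff_forall hG]
  push Not
  refine exists_congr fun x => (hadj.reachesSize_iff _ x).trans (exists_congr fun w => ?_)
  simp only [Nat.add_right_cancel_iff, Fin.val_inj]

theorem isExtendable_one_decidableInLinearTime :
    DecidableInLinearTime (fun _ G => G.IsChordal) (fun _ G => G.IsExtendable 1) := by
  refine ⟨extendableProg, 100, fun n G adj hG hadj => ?_⟩
  have hlen := hadj.totalLength_eq
  obtain ⟨t, s, he, ht, h1, h0⟩ := runs_extendableProg hG hadj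
    (B := 100 * (n + G.edgeSet.ncard + 1)) (T := 100 * (n + G.edgeSet.ncard + 1))
    (by omega) (by omega)
  refine ⟨t, s, he, ht, fun hQ => ?_, h0.2⟩
  have : s.reg 0 ≠ 0 := fun h => h0.1 h hQ
  clear h0
  omega

end RAM

theorem theorem5 :
    (∀ (V : Type*) [Finite V] (G : SimpleGraph V), G.IsChordal →
      (G.IsExtendable 1 ↔
        ∃ P : Finpartition (Set.univ : Set V),
          P.parts.card = G.indepNum ∧ ∀ C ∈ P.parts, Maximal G.IsClique C)) ∧
    RAM.DecidableInLinearTime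
      (fun _ G => G.IsChordal)
      (fun _ G => G.IsExtendable 1) :=
  ⟨fun _ _ _ hG => hG.isExtendable_one_iff_exists_finpartition,
    RAM.isExtendable_one_decidableInLinearTime⟩
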